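/- Identify the characteristic plane $M=\{x_5=0\}$ of the Heisenberg group $\mathbb H^2$ with $\mathbb R^4$, let $|\cdot|$ be the Euclidean norm, and put $$\omega(x,y)=x_1y_3-x_3y_1+x_2y_4-x_4y_2 .$$ The group law of $\mathbb H^2=\mathbb R^4\times\mathbb R$ is $(x,s)\cdot(y,t)=(x+y,\,s+t-\tfrac12\omega(x,y))$, with Korányi norm $\varrho(x,s)=(|x|^4+16s^2)^{1/4}$, and the distance induced on $M$ is $$d(x,y)=\varrho\big((x,0)^{-1}\cdot(y,0)\big)=\big(|x-y|^4+4\,\omega(x,y)^2\big)^{1/4}.$$ Define on $\mathbb R^4$ the vector fields (written as their coefficient vectors at $y$) $$T_1=(y_1,y_2,y_3,y_4),\quad T_2=(-y_4,y_3,-y_2,y_1),\quad T_3=(-y_2,y_1,y_4,-y_3),\quad T_4=(-y_3,-y_4,y_1,y_2),$$ and, for $y\neq0$, $Z_i=T_i/|y|$ for $i=1,2,3$. For $z\in\mathbb R^4$ let $Z_{4,y-z}=|y|^{-1}T_{4,y-z}$, where $T_{4,y-z}$ is $T_4$ with its coefficients evaluated at $y-z$. For a vector field $V$ let $V^*g=-\operatorname{div}(gV)$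 be its formal adjoint with respect to Lebesgue measure, and define $$\Delta_z u=\sum_{i=1}^3\frac1{|y|}Z_i^*\big(|y|\,Z_iu\big)+\frac1{|y|}Z_{4,y-z}^*\big(|y|\,Z_{4,y-z}u\big)$$ (so $-\Delta_z$ has the sign of the usual Laplacian). Let $Q=5$ and $$\Gamma(y,z)=\frac1{C_{\mathbb H\times\mathbb R}}\,d(y,z)^{-Q+2},\qquad C_{\mathbb H\times\mathbb R}=21\int_{\{(x_1^2+x_2^2+x_4^2)^2+4x_3^2\le1\}}(x_1^2+x_2^2+x_4^2)\,dx ,$$ and let $f_z(y)=\Delta_z\Gamma(\cdot,z)(y)$, computed classically at the points $y\notin\{0,z\}$. Then the following hold. 1. (Explicit expression.) For all $z\in\mathbb R^4$ and $y\notin\{0,z\}$, writing $d=d(y,z)$, $$f_z(y)=\frac{3\,d^{-11}}{4C_{\mathbb H\times\mathbb R}|y|^2}\Big(-\tfrac74R_{1,3}+d^4R_{2,3}+d^4R_{3,3}-112\,\omega(z,y)^4\Big),$$ where $$R_{1,3}=16\big(|y-z|^4+d^4\big)|y-z|^2\langle z,y-z\rangle,\qquad R_{2,3}=4\,\omega(z,y)^2+36|y-z|^2\langle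 z,y-z\rangle,$$ $$R_{3,3}=12|y-z|^2\langle z,y-z\rangle+24\,\omega(z,y)^2+\frac{8}{|y|^2}\langle z,y-z\rangle\,\omega(z,y)^2 .$$ 2. (Estimate.) There is an absolute constant $C>0$ such that for all $z\in\mathbb R^4$ and $y\notin\{0,z\}$ $$|f_z(y)|\le C\,\frac{\sqrt{|z||y|}+|z|}{|y|^2}\,d(y,z)^{-Q+1}.$$ 3. (Integrability.) For every $z\in\mathbb R^4$ the functions $\Gamma(\cdot,z)$ and $f_z$ are locally integrable on $\mathbb R^4$ with respect to Lebesgue measure. 4. (Equation.) For every $z\neq0$, $\Delta_z\Gamma(\cdot,z)=\delta_z+f_z$ in the distributional sense with respect to the measure $|y|\,dy$ (equivalently $(-\Delta_z)\Gamma(\cdot,z)=-\delta_z-f_z$). That is, for every $\varphi\in C_0^\infty(\mathbb R^4)$ all the integrands on the left below are integrable and $$\int\Gamma(y,z)\,\Delta_z\varphi(y)\,|y|\,dy=\varphi(z)+\int f_z(y)\,\varphi(y)\,|y|\,dy ,$$ $$\sum_{i=1}^3\int Z_i\Gamma(y,z)\,Z_i\varphi(y)\,|y|\,dy+\int Z_{4,y-z}\Gamma(y,z)\,Z_{4,y-z}\varphi(y)\,|y|\,dy=\varphi(z)+\int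 f_z(y)\,\varphi(y)\,|y|\,dy .$$ -/

import Mathlib

open MeasureTheory
open scoped ContDiff

namespace CharPlane

noncomputable section

/-- `ℝ⁴` with its Euclidean norm; it is identified with the characteristic plane
`M = {x₅ = 0}` of the Heisenberg group. Coordinates `x₁, …, x₄` are `x 0, …, x 3`. -/
abbrev Plane := EuclideanSpace ℝ (Fin 4)

/-! ### The Heisenberg group and the induced distance -/

/-- The bilinear form `x₁ y₃ - x₃ y₁ + x₂ y₄ - x₄ y₂`. -/
def omega (x y : Plane) : ℝ := x 0 * y 2 - x 2 * y 0 + x 1 * y 3 - x 3 * y 1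

/-- The group law of the Heisenberg group `ℍ²` on `ℝ⁴ × ℝ`. -/
def heisMul (p q : Plane × ℝ) : Plane × ℝ :=
  (p.1 + q.1, p.2 + q.2 - omega p.1 q.1 / 2)

/-- The inverse in `ℍ²`. -/
def heisInv (p : Plane × ℝ) : Plane × ℝ := (-p.1, -p.2)

/-- The Korányi norm on `ℍ²`. -/
def koranyi (p : Plane × ℝ) : ℝ := (‖p.1‖ ^ 4 + 16 * p.2 ^ 2) ^ (1 / 4 : ℝ)

/-- The gauge distance of `ℍ²`. -/
def heisDist (p q : Plane × ℝ) : ℝ := koranyi (heisMul (heisInv p) q)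

/-- The distance induced on the plane by its immersion `x ↦ (x, 0)` in `ℍ²`. -/
def d (x y : Plane) : ℝ := heisDist (x, 0) (y, 0)

theorem d_eq (x y : Plane) :
    d x y = (‖x - y‖ ^ 4 + 4 * omega x y ^ 2) ^ (1 / 4 : ℝ) := by
  have h1 : ‖-x + y‖ = ‖x - y‖ := by rw [← norm_neg]; congr 1; abel
  have h2 : omega (-x) y = -omega x y := by
    simp only [omega, PiLp.neg_apply]; ring
  simp only [d, heisDist, koranyi, heisMul, heisInv, h1, h2]
  congr 1
  ring

/-! ### The vector fields -/

/-- The matrix whose columns at the point `x` are `T₁, T₂, T₃, T₄`. -/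
def A (x : Plane) : Matrix (Fin 4) (Fin 4) ℝ :=
  !![x 0, -x 3, -x 1, -x 2;
     x 1,  x 2,  x 0, -x 3;
     x 2, -x 1,  x 3,  x 0;
     x 3,  x 0, -x 2,  x 1]

/-- The vector fields `T₁, T₂, T₃, T₄`, indexed by `0, 1, 2, 3`. -/
def T (j : Fin 4) (x : Plane) : Plane := WithLp.toLp 2 fun i => A x i j

/-- The frame of the operator with pole `z`: for `j = 0, 1, 2` it is `Z_{j+1} = T_{j+1} / |y|`,
and for `j = 3` it is `Z_{4,y-z}`, the field `T₄` with coefficients evaluated at `y - z`,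
divided by `|y|`. -/
def Z (z : Plane) (j : Fin 4) (y : Plane) : Plane :=
  ‖y‖⁻¹ • (if j = 3 then T 3 (y - z) else T j y)

/-- The derivative of `u` along the vector field `V`. -/
def along (V : Plane → Plane) (u : Plane → ℝ) (y : Plane) : ℝ := fderiv ℝ u y (V y)

/-- The formal adjoint of `along V` with respect to Lebesgue measure,
`V* g = - ∑ᵢ ∂ᵢ (g Vᵢ)`. -/
def adjointAlong (V : Plane → Plane) (g : Plane → ℝ) (y : Plane) : ℝ :=
  -∑ i, fderiv ℝ (fun w => g w * V w i) y (EuclideanSpace.single i 1)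

/-- The operator `Δ_z u = ∑_{i ≤ 3} |y|⁻¹ Z_i* (|y| Z_i u) + |y|⁻¹ Z_{4,y-z}* (|y| Z_{4,y-z} u)`. -/
def Lap (z : Plane) (u : Plane → ℝ) (y : Plane) : ℝ :=
  ∑ j, ‖y‖⁻¹ * adjointAlong (Z z j) (fun w => ‖w‖ * along (Z z j) u w) y

/-! ### The approximate fundamental solution -/

/-- The homogeneous dimension of the plane with respect to the measure `|y| dy`. -/
def Q : ℤ := 5

/-- The normalization constant. -/
def CHR : ℝ :=
  21 * ∫ x in {x : Plane | (x 0 ^ 2 + x 1 ^ 2 + x 3 ^ 2) ^ 2 + 4 * x 2 ^ 2 ≤ 1},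
    (x 0 ^ 2 + x 1 ^ 2 + x 3 ^ 2)

/-- `Γ(y, z) = C⁻¹ d(y, z)^{2 - Q}`. -/
def Gam (y z : Plane) : ℝ := CHR⁻¹ * d y z ^ (-Q + 2)

/-- `f_z(y) = Δ_z Γ(·, z) (y)`, computed classically away from the pole. -/
def f (z y : Plane) : ℝ := Lap z (fun w => Gam w z) y

/-! ### The terms of the explicit expression of `f_z`

For `z = (z₁, 0, 0, 0)` one has `⟪z, y - z⟫ = z₁ (y - z)₁` and `omega z y = z₁ y₃`. -/

def R13 (y z : Plane) : ℝ :=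
  16 * (‖y - z‖ ^ 4 + d y z ^ 4) * ‖y - z‖ ^ 2 * inner ℝ z (y - z)

def R23 (y z : Plane) : ℝ :=
  4 * omega z y ^ 2 + 36 * ‖y - z‖ ^ 2 * inner ℝ z (y - z)

def R33 (y z : Plane) : ℝ :=
  12 * ‖y - z‖ ^ 2 * inner ℝ z (y - z) + 24 * omega z y ^ 2
    + 8 / ‖y‖ ^ 2 * inner ℝ z (y - z) * omega z y ^ 2

end

end CharPlane

open CharPlane

open MeasureTheory
open scoped ContDiff

namespace CharPlane

noncomputable section

open Filter Topology

/-! Put V_j = |y| Z_j, with V_4 taken at y - z. These fields are polynomial, and |y| Δ_z u =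
-div(|y|⁻¹ Σ (V_j u) V_j), so the operator is degenerate only through the weight |y|⁻¹, which is
locally integrable together with its gradient in dimension four. Green's formula therefore holds
across the origin (`integral_mul_Lap`).

Let N = d⁴, a polynomial, so that Γ = C⁻¹ N^(-3/4). By the chain rule, Δ_z of any function of N
depends only on the weighted divergence of grad N and on Σ (V_j N)², both computed in closed form
(`wdv_grad_N`, `fderiv_N_grad_N`). For the power -3/4 the top order terms cancel, which gives the
formula `f_eq`. Every surviving term carries a factor of size |z|, whence `abs_f_le`: |f_z| ≲ |z|
|y|⁻² d⁻⁴.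

For the equation, Γ is replaced by the smooth kernel Γ_ε = C⁻¹ (N + ε)^(-3/4). By
`norm_mul_Lap_Gr_eq`, |y| Δ_z Γ_ε is (N/(N+ε))^(7/4) |y| f_z plus 21 C⁻¹ ε (N+ε)^(-11/4) (|y| |y-z|²
- err). The first part tends to |y| f_z by domination. The err part is of lower order and vanishes
in the limit. The remaining part is an approximate identity at z. In coordinates adapted to T_1, …,
T_4 at z, with anisotropic dilations of Jacobian t⁵/|z| and ε = t⁴, all powers of t cancel and the
limit is an integral over the model ℍ × ℝ (`tendsto_integral_blow`). A layer cake computation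
identifies that integral with C/21 (`integral_hor_one_add_gauge`), so the total mass is one.

All limits are dominated by (1 + |y|⁻²)(1 + N⁻¹) times a compactly supported function. This majorant
is locally integrable for z ≠ 0, since its two singularities are then apart and d⁻⁴ is integrable at
z in homogeneous dimension 5. -/

/-! ### Polynomial frame, weighted divergence, and the operator in divergence form -/

/-- `‖y‖ Z_j`. -/
def V (z : Plane) (j : Fin 4) (y : Plane) : Plane := if j = 3 then T 3 (y - z) else T j y

theorem Z_eq (z : Plane) (j : Fin 4) (y : Plane) : Z z j y = ‖y‖⁻¹ • V z j y := rfl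

/-- Divergence. -/
def dv (X : Plane → Plane) (y : Plane) : ℝ :=
  ∑ i, fderiv ℝ (fun w => X w i) y (EuclideanSpace.single i 1)

/-- The vector field `∑ⱼ (Vⱼ u) Vⱼ`. -/
def grad (z : Plane) (u : Plane → ℝ) (y : Plane) : Plane :=
  ∑ j, fderiv ℝ u y (V z j y) • V z j y

theorem contDiff_T (j : Fin 4) {n : WithTop ℕ∞} : ContDiff ℝ n (T j) := by
  rw [contDiff_euclidean]
  intro i
  fin_cases j <;> fin_cases i <;> simp [T, A] <;> fun_prop

theorem contDiff_V (z : Plane) (j : Fin 4) {n : WithTop ℕ∞} : ContDiff ℝ n (V z j) := by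
  unfold V
  split_ifs
  · exact (contDiff_T 3).comp (contDiff_id.sub contDiff_const)
  · exact contDiff_T j

theorem contDiffAt_along_V (z : Plane) (j : Fin 4) {u : Plane → ℝ} {y : Plane}
    (hu : ContDiffAt ℝ 2 u y) : ContDiffAt ℝ 1 (fun w => fderiv ℝ u w (V z j w)) y :=
  (hu.fderiv_right (m := 1) (by norm_num)).clm_apply (contDiff_V z j).contDiffAt

theorem contDiffAt_grad (z : Plane) {u : Plane → ℝ} {y : Plane}
    (hu : ContDiffAt ℝ 2 u y) : ContDiffAt ℝ 1 (grad z u) y :=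
  ContDiffAt.sum fun j _ => (contDiffAt_along_V z j hu).smul (contDiff_V z j).contDiffAt

theorem contDiff_grad (z : Plane) {u : Plane → ℝ} (hu : ContDiff ℝ 2 u) :
    ContDiff ℝ 1 (grad z u) :=
  contDiff_iff_contDiffAt.2 fun _ => contDiffAt_grad z hu.contDiffAt

theorem hasFDerivAt_norm_inv {y : Plane} (hy : y ≠ 0) :
    HasFDerivAt (fun w : Plane => ‖w‖⁻¹) (-(‖y‖⁻¹ ^ 3) • innerSL ℝ y) y := by
  have h1 : HasFDerivAt (fun w : Plane => ‖w‖) (‖y‖⁻¹ • innerSL ℝ y) y := by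
    have h := (hasStrictFDerivAt_norm_sq y).hasFDerivAt.sqrt (by positivity)
    have h2 : (fun w : Plane => √(‖w‖ ^ 2)) = fun w => ‖w‖ := by
      ext w; rw [Real.sqrt_sq (norm_nonneg _)]
    rw [h2] at h
    refine h.congr_fderiv ?_
    ext v
    rw [Real.sqrt_sq (norm_nonneg y)]
    simp
    ring
  refine ((hasDerivAt_inv (norm_ne_zero_iff.2 hy)).comp_hasFDerivAt y h1).congr_fderiv ?_
  ext v
  simp
  ring

theorem dv_smul {g : Plane → ℝ} {X : Plane → Plane} {y : Plane} (hg : DifferentiableAt ℝ g y)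
    (hX : DifferentiableAt ℝ X y) :
    dv (fun w => g w • X w) y = g y * dv X y + fderiv ℝ g y (X y) := by
  have hX' := fun i => (differentiableAt_euclidean.1 hX) i
  have h1 : X y = ∑ i, X y i • EuclideanSpace.single i (1 : ℝ) := by
    ext k; simp [Finset.sum_apply, Pi.single_apply]
  have h2 : fderiv ℝ g y (X y) = ∑ i, X y i * fderiv ℝ g y (EuclideanSpace.single i 1) := by
    conv_lhs => rw [h1]
    simp
  rw [h2, dv, dv, Finset.mul_sum, ← Finset.sum_add_distrib]
  refine Finset.sum_congr rfl fun i _ => ?_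
  simp only [PiLp.smul_apply, smul_eq_mul]
  rw [fderiv_fun_mul hg (hX' i)]
  simp

theorem dv_add {X Y : Plane → Plane} {y : Plane} (hX : DifferentiableAt ℝ X y)
    (hY : DifferentiableAt ℝ Y y) : dv (fun w => X w + Y w) y = dv X y + dv Y y := by
  simp only [dv, ← Finset.sum_add_distrib]
  refine Finset.sum_congr rfl fun i _ => ?_
  simp only [PiLp.add_apply]
  rw [fderiv_fun_add ((differentiableAt_euclidean.1 hX) i) ((differentiableAt_euclidean.1 hY) i)]
  simp

theorem dv_sum {ι : Type*} (s : Finset ι) {X : ι → Plane → Plane} {y : Plane}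
    (hX : ∀ j ∈ s, DifferentiableAt ℝ (X j) y) :
    dv (fun w => ∑ j ∈ s, X j w) y = ∑ j ∈ s, dv (X j) y := by
  classical
  induction s using Finset.induction_on with
  | empty => simp [dv]
  | insert a s ha ih =>
    simp only [Finset.sum_insert ha]
    rw [dv_add (hX a (by simp)) (DifferentiableAt.fun_sum fun j hj => hX j (by simp [hj])),
      ih fun j hj => hX j (by simp [hj])]

theorem dv_congr {X Y : Plane → Plane} {y : Plane} (h : X =ᶠ[𝓝 y] Y) : dv X y = dv Y y := by
  refine Finset.sum_congr rfl fun i _ => ?_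
  have : (fun w => X w i) =ᶠ[𝓝 y] fun w => Y w i := h.mono fun w hw => by simp only [hw]
  rw [this.fderiv_eq]

/-- The divergence of `‖y‖⁻¹ X`, in expanded form. -/
def wdv (X : Plane → Plane) (y : Plane) : ℝ :=
  ‖y‖⁻¹ * dv X y - ‖y‖⁻¹ ^ 3 * inner ℝ y (X y)

theorem dv_norm_inv_smul {X : Plane → Plane} {y : Plane} (hy : y ≠ 0)
    (hX : DifferentiableAt ℝ X y) : dv (fun w => ‖w‖⁻¹ • X w) y = wdv X y := by
  rw [dv_smul (hasFDerivAt_norm_inv hy).differentiableAt hX, (hasFDerivAt_norm_inv hy).fderiv, wdv]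
  simp
  ring

/-- The weight |y| cancels one of the two factors |y|⁻¹ coming from the fields, which leaves smooth
polynomial fields and a single singular weight. -/
theorem norm_mul_Lap (z : Plane) {u : Plane → ℝ} {y : Plane} (hy : y ≠ 0)
    (hu : ContDiffAt ℝ 2 u y) : ‖y‖ * Lap z u y = -wdv (grad z u) y := by
  have hne : ∀ᶠ w in 𝓝 y, w ≠ 0 := isOpen_ne.mem_nhds hy
  have hd : ∀ j, DifferentiableAt ℝ (fun w => fderiv ℝ u w (V z j w) • V z j w) y := fun j =>
    ((contDiffAt_along_V z j hu).smul (contDiff_V z j).contDiffAt).differentiableAt one_ne_zero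
  have hn : DifferentiableAt ℝ (fun w : Plane => ‖w‖⁻¹) y :=
    (hasFDerivAt_norm_inv hy).differentiableAt
  have h1 : ∀ j, adjointAlong (Z z j) (fun w => ‖w‖ * along (Z z j) u w) y
      = -dv (fun w => ‖w‖⁻¹ • fderiv ℝ u w (V z j w) • V z j w) y := by
    intro j
    rw [adjointAlong]
    congr 1
    refine dv_congr (X := fun w => (‖w‖ * along (Z z j) u w) • Z z j w) ?_
    filter_upwards [hne] with w hw
    have hw' : ‖w‖ ≠ 0 := norm_ne_zero_iff.2 hw
    simp only [along, Z_eq, map_smul, smul_smul, smul_eq_mul]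
    congr 1
    field_simp
  have hy' : ‖y‖ ≠ 0 := norm_ne_zero_iff.2 hy
  rw [← dv_norm_inv_smul hy ((contDiffAt_grad z hu).differentiableAt one_ne_zero), Lap,
    ← Finset.mul_sum, mul_inv_cancel_left₀ hy']
  simp only [h1, grad, Finset.smul_sum, Finset.sum_neg_distrib]
  rw [dv_sum (X := fun j w => ‖w‖⁻¹ • fderiv ℝ u w (V z j w) • V z j w) _
    fun j _ => hn.smul (hd j)]

/-! ### Divergence theorem with the weight |y|⁻¹ and Green's formula -/

theorem integral_fderiv_apply_eq_zero {F : Plane → ℝ} (hF : ContDiff ℝ 1 F)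
    (hc : HasCompactSupport F) (v : Plane) : ∫ y, fderiv ℝ F y v = 0 := by
  have h := integral_mul_fderiv_eq_neg_fderiv_mul_of_integrable (μ := (volume : Measure Plane))
    (f := fun _ => (1 : ℝ)) (g := F) (v := v) (by simp)
    (by
      simp only [one_mul]
      exact ((hF.continuous_fderiv one_ne_zero).clm_apply
        continuous_const).integrable_of_hasCompactSupport (hc.fderiv_apply (𝕜 := ℝ) v))
    (by simpa using hF.continuous.integrable_of_hasCompactSupport hc)
    (fun _ _ => differentiableAt_const _) (fun x _ => hF.differentiable one_ne_zero x)
  simpa using h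

theorem contDiff_coord {X : Plane → Plane} {n : WithTop ℕ∞} (hX : ContDiff ℝ n X) (i : Fin 4) :
    ContDiff ℝ n (fun w => X w i) := (contDiff_euclidean.1 hX) i

theorem HasCompactSupport.coord {X : Plane → Plane} (hc : HasCompactSupport X) (i : Fin 4) :
    HasCompactSupport (fun w => X w i) :=
  hc.comp_left (g := fun x : Plane => x i) rfl

theorem continuous_dv {X : Plane → Plane} (hX : ContDiff ℝ 1 X) : Continuous (dv X) :=
  continuous_finsetSum _ fun i _ =>
    ((contDiff_coord hX i).continuous_fderiv one_ne_zero).clm_apply continuous_const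

theorem hasCompactSupport_dv {X : Plane → Plane} (hc : HasCompactSupport X) :
    HasCompactSupport (dv X) := by
  refine hc.mono' fun y hy => ?_
  by_contra h
  have h0 : X =ᶠ[𝓝 y] fun _ => 0 := notMem_tsupport_iff_eventuallyEq.1 h
  apply hy
  rw [dv_congr h0]
  simp [dv]

theorem integral_dv_eq_zero {X : Plane → Plane} (hX : ContDiff ℝ 1 X) (hc : HasCompactSupport X) :
    ∫ y, dv X y = 0 := by
  unfold dv
  rw [integral_finsetSum]
  · exact Finset.sum_eq_zero fun i _ =>
      integral_fderiv_apply_eq_zero (contDiff_coord hX i) (HasCompactSupport.coord hc i) _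
  · intro i _
    exact (((contDiff_coord hX i).continuous_fderiv one_ne_zero).clm_apply
      continuous_const).integrable_of_hasCompactSupport
        ((HasCompactSupport.coord hc i).fderiv_apply (𝕜 := ℝ) _)

theorem locallyIntegrable_norm_inv_pow {k : ℕ} (hk : k < 4) :
    LocallyIntegrable (fun y : Plane => ‖y‖⁻¹ ^ k) volume := by
  refine locallyIntegrable_of_norm_le_rpow (C := 1) (α := k) (by simp) (by simpa using hk)
    (Eventually.of_forall fun y => ?_) (by fun_prop)
  rw [Real.rpow_neg (norm_nonneg _), Real.rpow_natCast, one_mul]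
  simp

theorem integrable_norm_inv_pow_mul {k : ℕ} (hk : k < 4) {g : Plane → ℝ} (hg : Continuous g)
    (hc : HasCompactSupport g) : Integrable (fun y => ‖y‖⁻¹ ^ k * g y) volume := by
  simpa [mul_comm] using
    (locallyIntegrable_norm_inv_pow hk).integrable_smul_left_of_hasCompactSupport hg hc

theorem abs_inner_div_le (y x : Plane) : ‖‖y‖⁻¹ ^ 3 * inner ℝ y x‖ ≤ ‖y‖⁻¹ ^ 2 * ‖x‖ := by
  rcases eq_or_ne y 0 with rfl | hy
  · simp
  have hy' : 0 < ‖y‖ := norm_pos_iff.2 hy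
  calc ‖‖y‖⁻¹ ^ 3 * inner ℝ y x‖ = ‖y‖⁻¹ ^ 3 * ‖(inner ℝ y x : ℝ)‖ := by
        rw [norm_mul]; simp
    _ ≤ ‖y‖⁻¹ ^ 3 * (‖y‖ * ‖x‖) := by gcongr; exact norm_inner_le_norm y x
    _ = ‖y‖⁻¹ ^ 2 * ‖x‖ := by field_simp

theorem integrable_wdv {X : Plane → Plane} (hX : ContDiff ℝ 1 X) (hc : HasCompactSupport X) :
    Integrable (wdv X) volume := by
  have h1 := integrable_norm_inv_pow_mul (k := 1) (by norm_num) (continuous_dv hX)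
    (hasCompactSupport_dv hc)
  have h2 := integrable_norm_inv_pow_mul (k := 2) (by norm_num) hX.continuous.norm hc.norm
  simp only [pow_one] at h1
  refine h1.sub (h2.mono' ?_ (Eventually.of_forall fun y => abs_inner_div_le y _))
  have := hX.continuous
  refine AEStronglyMeasurable.mul ?_ ?_
  · exact (measurable_norm.inv.pow_const 3).aestronglyMeasurable
  · exact (continuous_id.inner this).aestronglyMeasurable

theorem hasCompactSupport_smul {g : Plane → ℝ} {X : Plane → Plane} (hc : HasCompactSupport X) :
    HasCompactSupport (fun w => g w • X w) :=
  HasCompactSupport.mono hc fun y hy h => hy (by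
    have h' : X y = 0 := h
    change g y • X y = 0
    rw [h', smul_zero])

theorem hasCompactSupport_smul' {g : Plane → ℝ} {X : Plane → Plane} (hc : HasCompactSupport g) :
    HasCompactSupport (fun w => g w • X w) :=
  HasCompactSupport.mono hc fun y hy h => hy (by
    have h' : g y = 0 := h
    change g y • X y = 0
    rw [h', zero_smul])

theorem hasCompactSupport_grad (z : Plane) {u : Plane → ℝ} (hc : HasCompactSupport u) :
    HasCompactSupport (grad z u) := by
  refine HasCompactSupport.mono' hc fun y hy => ?_
  by_contra h
  have h0 : u =ᶠ[𝓝 y] fun _ => 0 := notMem_tsupport_iff_eventuallyEq.1 h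
  apply hy
  simp [grad, h0.fderiv_eq]

/-- The singular weight creates no boundary term at the origin: it is approximated by (|y|² +
δ)^(-1/2), for which the ordinary divergence theorem applies, and |y|⁻¹, |y|⁻² are integrable enough
in dimension four to let δ tend to 0. -/
theorem integral_wdv_eq_zero {X : Plane → Plane} (hX : ContDiff ℝ 1 X)
    (hc : HasCompactSupport X) : ∫ y, wdv X y = 0 := by
  have hXd := hX.differentiable one_ne_zero
  have hXc := hX.continuous
  set q : ℝ → Plane → ℝ := fun δ w => (√(‖w‖ ^ 2 + δ))⁻¹ with hq
  have hqd : ∀ δ > 0, ContDiff ℝ 1 (q δ) := fun δ hδ =>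
    ContDiff.inv (ContDiff.sqrt ((contDiff_norm_sq ℝ).add contDiff_const) fun x => by positivity)
      fun x => by positivity
  have hqf : ∀ δ > 0, ∀ y, HasFDerivAt (q δ) (-(q δ y) ^ 3 • innerSL ℝ y) y := by
    intro δ hδ y
    have h1 := ((hasStrictFDerivAt_norm_sq y).hasFDerivAt.add_const δ).sqrt (by positivity)
    have h2 : √(‖y‖ ^ 2 + δ) ≠ 0 := by positivity
    refine ((hasDerivAt_inv h2).comp_hasFDerivAt y h1).congr_fderiv ?_
    ext v
    simp [hq]
    ring
  have hz : ∀ δ > 0, ∫ y, (q δ y * dv X y - q δ y ^ 3 * inner ℝ y (X y)) = 0 := by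
    intro δ hδ
    rw [← integral_dv_eq_zero (X := fun w => q δ w • X w) ((hqd δ hδ).smul hX)
      (hasCompactSupport_smul hc)]
    congr 1
    ext y
    rw [dv_smul (hqf δ hδ y).differentiableAt (hXd y), (hqf δ hδ y).fderiv]
    simp
    ring
  have hle : ∀ δ > 0, ∀ y : Plane, y ≠ 0 → q δ y ≤ ‖y‖⁻¹ := by
    intro δ hδ y hy
    have : 0 < ‖y‖ := norm_pos_iff.2 hy
    refine inv_anti₀ this ?_
    rw [Real.le_sqrt' this]
    linarith [hδ]
  have hne : ∀ᵐ y : Plane, y ≠ 0 := by simp [ae_iff]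
  have hlim : Tendsto (fun δ => ∫ y, (q δ y * dv X y - q δ y ^ 3 * inner ℝ y (X y))) (𝓝[>] 0)
      (𝓝 (∫ y, wdv X y)) := by
    refine tendsto_integral_filter_of_dominated_convergence
      (fun y => ‖y‖⁻¹ ^ 1 * ‖dv X y‖ + ‖y‖⁻¹ ^ 2 * ‖X y‖) ?_ ?_ ?_ ?_
    · filter_upwards [self_mem_nhdsWithin] with δ hδ
      have h1 := (hqd δ hδ).continuous
      have h2 := continuous_dv hX
      exact Continuous.aestronglyMeasurable (by fun_prop)
    · filter_upwards [self_mem_nhdsWithin] with δ hδ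
      filter_upwards [hne] with y hy
      have hq0 : 0 ≤ q δ y := by positivity
      refine (norm_sub_le _ _).trans (add_le_add ?_ (le_trans ?_ (abs_inner_div_le y (X y))))
      · rw [norm_mul, Real.norm_of_nonneg hq0, pow_one]
        gcongr
        exact hle δ hδ y hy
      · rw [norm_mul, norm_mul, norm_pow, norm_pow, Real.norm_of_nonneg hq0, norm_inv, norm_norm]
        gcongr
        exact hle δ hδ y hy
    · exact (integrable_norm_inv_pow_mul (by norm_num) (continuous_dv hX).norm
        (hasCompactSupport_dv hc).norm).add
        (integrable_norm_inv_pow_mul (by norm_num) hXc.norm hc.norm)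
    · filter_upwards [hne] with y hy
      have hy' : 0 < ‖y‖ := norm_pos_iff.2 hy
      have hqt : Tendsto (fun δ => q δ y) (𝓝[>] 0) (𝓝 ‖y‖⁻¹) := by
        have : ContinuousAt (fun δ => q δ y) 0 := by
          refine ContinuousAt.inv₀ (by fun_prop) ?_
          simp [hy]
        have h2 := this.tendsto.mono_left (nhdsWithin_le_nhds (s := Set.Ioi 0))
        simpa [hq, Real.sqrt_sq hy'.le] using h2
      exact (hqt.mul_const _).sub ((hqt.pow 3).mul_const _)
  refine tendsto_nhds_unique hlim (tendsto_const_nhds.congr' ?_)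
  filter_upwards [self_mem_nhdsWithin] with δ hδ
  exact (hz δ hδ).symm

theorem wdv_smul {g : Plane → ℝ} {X : Plane → Plane} {y : Plane} (hg : DifferentiableAt ℝ g y)
    (hX : DifferentiableAt ℝ X y) :
    wdv (fun w => g w • X w) y = g y * wdv X y + ‖y‖⁻¹ * fderiv ℝ g y (X y) := by
  rw [wdv, dv_smul hg hX, wdv, inner_smul_right]
  ring

/-- Green's formula for the operator `Δ_z`. -/
theorem integral_mul_Lap (z : Plane) {u v : Plane → ℝ} (hu : ContDiff ℝ 2 u)
    (hv : ContDiff ℝ 2 v) (hc : HasCompactSupport u ∨ HasCompactSupport v) :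
    Integrable (fun y => v y * (‖y‖ * Lap z u y)) volume ∧
    ∫ y, v y * (‖y‖ * Lap z u y)
      = ∫ y, ‖y‖⁻¹ * ∑ j, fderiv ℝ u y (V z j y) * fderiv ℝ v y (V z j y) := by
  have hv1 : ContDiff ℝ 1 v := hv.of_le (by norm_num)
  have hX : ContDiff ℝ 1 (fun y => v y • grad z u y) := hv1.smul (contDiff_grad z hu)
  have hcX : HasCompactSupport (fun y => v y • grad z u y) := by
    rcases hc with hc | hc
    · exact hasCompactSupport_smul (hasCompactSupport_grad z hc)
    · exact hasCompactSupport_smul' hc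
  have hne : ∀ᵐ y : Plane, y ≠ 0 := by simp [ae_iff]
  have key : ∀ᵐ y : Plane, wdv (fun y => v y • grad z u y) y = -(v y * (‖y‖ * Lap z u y))
      + ‖y‖⁻¹ * ∑ j, fderiv ℝ u y (V z j y) * fderiv ℝ v y (V z j y) := by
    filter_upwards [hne] with y hy
    rw [wdv_smul (hv1.differentiable one_ne_zero y)
      ((contDiff_grad z hu).differentiable one_ne_zero y), norm_mul_Lap z hy hu.contDiffAt]
    simp [grad]
  have hu1 := hu.continuous_fderiv (by norm_num)
  have hv2 := hv.continuous_fderiv (by norm_num)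
  have hVc := fun j => (contDiff_V z j (n := 0)).continuous
  have hint : Integrable
      (fun y => ‖y‖⁻¹ * ∑ j, fderiv ℝ u y (V z j y) * fderiv ℝ v y (V z j y)) volume := by
    have := integrable_norm_inv_pow_mul (k := 1)
      (g := fun y => ∑ j, fderiv ℝ u y (V z j y) * fderiv ℝ v y (V z j y)) (by norm_num)
      (by fun_prop) ?_
    · simpa using this
    · rcases hc with hc | hc
      · refine (hc.fderiv (𝕜 := ℝ)).mono fun y hy h => hy ?_
        simp [h]
      · refine (hc.fderiv (𝕜 := ℝ)).mono fun y hy h => hy ?_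
        simp [h]
  have h1 : Integrable (fun y => v y * (‖y‖ * Lap z u y)) volume := by
    refine (hint.sub (integrable_wdv hX hcX)).congr ?_
    filter_upwards [key] with y hy
    simp only [Pi.sub_apply, hy]
    ring
  refine ⟨h1, ?_⟩
  have h0 := integral_wdv_eq_zero hX hcX
  have h2 : Integrable (fun y => -(v y * (‖y‖ * Lap z u y))) volume := h1.neg
  rw [integral_congr_ae key, integral_add h2 hint, integral_neg] at h0
  linarith

/-! ### The polynomial N = d⁴ and its horizontal derivatives -/

/-- The fourth power of the distance to the pole `z`. -/
def N (z y : Plane) : ℝ := ‖y - z‖ ^ 4 + 4 * omega y z ^ 2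

theorem inner_eq (x y : Plane) :
    (inner ℝ x y : ℝ) = x 0 * y 0 + x 1 * y 1 + x 2 * y 2 + x 3 * y 3 := by
  simp [PiLp.inner_apply, Fin.sum_univ_four]
  ring

theorem norm_sq_eq (x : Plane) : ‖x‖ ^ 2 = x 0 ^ 2 + x 1 ^ 2 + x 2 ^ 2 + x 3 ^ 2 := by
  simp [EuclideanSpace.norm_sq_eq, Fin.sum_univ_four]

theorem T_three (x : Plane) : T 3 x = !₂[-x 2, -x 3, x 0, x 1] := by
  ext i; fin_cases i <;> simp [T, A]

theorem omega_eq_inner (y z : Plane) : omega y z = -inner ℝ (T 3 z) y := by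
  rw [inner_eq, T_three]; simp [omega]; ring

theorem omega_swap (y z : Plane) : omega z y = -omega y z := by
  simp only [omega]; ring

theorem hasFDerivAt_omega (y z : Plane) :
    HasFDerivAt (fun y => omega y z) (-innerSL ℝ (T 3 z)) y := by
  have h : (fun y => omega y z) = fun y => (-innerSL ℝ (T 3 z)) y := by
    ext y; simp [omega_eq_inner]
  rw [h]
  exact ContinuousLinearMap.hasFDerivAt _

theorem hasFDerivAt_norm_sub_sq (y z : Plane) :
    HasFDerivAt (fun y : Plane => ‖y - z‖ ^ 2) ((2 : ℝ) • innerSL ℝ (y - z)) y := by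
  have := ((hasFDerivAt_id y).sub_const z).norm_sq
  refine this.congr_fderiv ?_
  ext v
  simp

theorem hasFDerivAt_N (y z : Plane) :
    HasFDerivAt (N z) ((4 * ‖y - z‖ ^ 2) • innerSL ℝ (y - z)
      - (8 * omega y z) • innerSL ℝ (T 3 z)) y := by
  have h := ((hasFDerivAt_norm_sub_sq y z).pow 2).add (((hasFDerivAt_omega y z).pow 2).const_mul 4)
  have hN : N z = fun y => (‖y - z‖ ^ 2) ^ 2 + 4 * omega y z ^ 2 := by
    ext y; simp only [N]; ring
  rw [hN]
  refine h.congr_fderiv ?_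
  ext v
  simp
  ring

theorem contDiff_omega (z : Plane) {n : WithTop ℕ∞} : ContDiff ℝ n (fun y => omega y z) := by
  unfold omega; fun_prop

theorem contDiff_N (z : Plane) {n : WithTop ℕ∞} : ContDiff ℝ n (N z) := by
  have hN : N z = fun y => (‖y - z‖ ^ 2) ^ 2 + 4 * omega y z ^ 2 := by
    ext y; simp only [N]; ring
  rw [hN]
  exact (((contDiff_id.sub contDiff_const).norm_sq ℝ).pow 2).add
    (contDiff_const.mul ((contDiff_omega z).pow 2))

theorem V_zero (z y : Plane) : V z 0 y = !₂[y 0, y 1, y 2, y 3] := by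
  ext i; fin_cases i <;> simp [V, T, A]

theorem V_one (z y : Plane) : V z 1 y = !₂[-y 3, y 2, -y 1, y 0] := by
  ext i; fin_cases i <;> simp [V, T, A]

theorem V_two (z y : Plane) : V z 2 y = !₂[-y 1, y 0, y 3, -y 2] := by
  ext i; fin_cases i <;> simp [V, T, A]

theorem V_three (z y : Plane) : V z 3 y = T 3 (y - z) := by
  simp [V]

/-- Since T_1, …, T_4 at y are orthogonal of length |y|, the sum equals |y|² ∇N minus its T_4(y)
term plus the T_4(y - z) term, where ∇N = 4|y-z|² (y-z) - 8 ω T_4(z). The two inner products needed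
are ⟨∇N, T_4(y)⟩ = -4 ω (|y|² + |z|²) and ⟨∇N, T_4(y-z)⟩ = -8 ω ⟨z, y-z⟩. -/
theorem grad_N (z y : Plane) : grad z (N z) y =
    (4 * ‖y‖ ^ 2 * ‖y - z‖ ^ 2) • (y - z) + (-8 * omega y z * ‖y‖ ^ 2) • T 3 z
      + (4 * omega y z * (‖y‖ ^ 2 + ‖z‖ ^ 2)) • T 3 y
      + (-8 * omega y z * inner ℝ z (y - z)) • T 3 (y - z) := by
  rw [grad, Fin.sum_univ_four, (hasFDerivAt_N y z).fderiv, V_zero, V_one, V_two, V_three]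
  simp only [T_three, sub_apply, smul_apply,
    innerSL_apply_apply, inner_eq, norm_sq_eq, omega]
  ext i
  fin_cases i <;> simp <;> ring

theorem fderiv_coord (k : Fin 4) (y v : Plane) : fderiv ℝ (fun w : Plane => w k) y v = v k := by
  have : HasFDerivAt (fun w : Plane => w k) (EuclideanSpace.proj k : Plane →L[ℝ] ℝ) y :=
    (EuclideanSpace.proj k : Plane →L[ℝ] ℝ).hasFDerivAt
  rw [this.fderiv]; rfl

theorem dv_T_three (y : Plane) : dv (T 3) y = 0 := by
  simp [dv, Fin.sum_univ_four, T, A, fderiv_fun_neg, fderiv_coord]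

theorem dv_sub_const (X : Plane → Plane) (z y : Plane) :
    dv (fun w => X (w - z)) y = dv X (y - z) := by
  refine Finset.sum_congr rfl fun i _ => ?_
  rw [fderiv_comp_sub (f := fun w => X w i)]

theorem dv_id (y : Plane) : dv (fun w => w) y = 4 := by
  simp [dv, fderiv_coord]

theorem dv_const (x y : Plane) : dv (fun _ => x) y = 0 := by
  simp [dv]

section Relations

variable (z y : Plane)

theorem norm_sq_expand : ‖y‖ ^ 2 = ‖y - z‖ ^ 2 + 2 * inner ℝ z (y - z) + ‖z‖ ^ 2 := by
  simp only [norm_sq_eq, inner_eq, PiLp.sub_apply]; ring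

theorem inner_sub_T_pole : (inner ℝ (y - z) (T 3 z) : ℝ) = -omega y z := by
  simp [inner_eq, T_three, omega]; ring

theorem inner_sub_T : (inner ℝ (y - z) (T 3 y) : ℝ) = -omega y z := by
  simp [inner_eq, T_three, omega]; ring

theorem inner_sub_T_sub : (inner ℝ (y - z) (T 3 (y - z)) : ℝ) = 0 := by
  simp [inner_eq, T_three]; ring

theorem inner_T_pole_sub : (inner ℝ (T 3 z) (y - z) : ℝ) = -omega y z := by
  simp [inner_eq, T_three, omega]; ring

theorem inner_T_self : (inner ℝ (T 3 z) (T 3 z) : ℝ) = ‖z‖ ^ 2 := by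
  simp [T_three, norm_sq_eq]; ring

theorem inner_T_pole_T : (inner ℝ (T 3 z) (T 3 y) : ℝ) = inner ℝ z (y - z) + ‖z‖ ^ 2 := by
  simp [inner_eq, T_three, norm_sq_eq]; ring

theorem inner_T_pole_T_sub : (inner ℝ (T 3 z) (T 3 (y - z)) : ℝ) = inner ℝ z (y - z) := by
  simp [inner_eq, T_three]; ring

theorem inner_self_sub : (inner ℝ y (y - z) : ℝ) = ‖y - z‖ ^ 2 + inner ℝ z (y - z) := by
  simp [inner_eq, norm_sq_eq]; ring

theorem inner_self_T_pole : (inner ℝ y (T 3 z) : ℝ) = -omega y z := by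
  simp [inner_eq, T_three, omega]; ring

theorem inner_self_T : (inner ℝ y (T 3 y) : ℝ) = 0 := by
  simp [inner_eq, T_three]; ring

theorem inner_self_T_sub : (inner ℝ y (T 3 (y - z)) : ℝ) = omega y z := by
  simp [inner_eq, T_three, omega]; ring

theorem inner_pole_T_sub : (inner ℝ z (T 3 (y - z)) : ℝ) = omega y z := by
  simp [inner_eq, T_three, omega]; ring

/-- The square length `∑ⱼ (Vⱼ N)²` of the gradient of `N`. -/
theorem fderiv_N_grad_N : fderiv ℝ (N z) y (grad z (N z) y) =
    16 * ‖y‖ ^ 2 * ‖y - z‖ ^ 2 * N z y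
      - 16 * omega y z ^ 2 * ‖y - z‖ ^ 2 * (‖y - z‖ ^ 2 + 4 * inner ℝ z (y - z)) := by
  rw [grad_N, (hasFDerivAt_N y z).fderiv]
  simp only [sub_apply, smul_apply, innerSL_apply_apply,
    inner_add_right, inner_smul_right, smul_eq_mul, inner_sub_T_pole z y, inner_sub_T z y,
    inner_sub_T_sub z y, inner_T_pole_sub z y, inner_T_self z, inner_T_pole_T z y,
    inner_T_pole_T_sub z y,
    real_inner_self_eq_norm_sq, N, norm_sq_expand z y]
  ring

theorem inner_grad_N : (inner ℝ y (grad z (N z) y) : ℝ) =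
    4 * ‖y‖ ^ 2 * ‖y - z‖ ^ 2 * (‖y - z‖ ^ 2 + inner ℝ z (y - z))
      + 8 * omega y z ^ 2 * ‖y‖ ^ 2 - 8 * omega y z ^ 2 * inner ℝ z (y - z) := by
  rw [grad_N]
  simp only [inner_add_right, inner_smul_right, inner_self_sub z y, inner_self_T_pole z y, inner_self_T y,
    inner_self_T_sub z y]
  ring

/-- In the closed form of the gradient the fields T_4 and T_4(z) are divergence free, so apart from
div(y - z) = 4 only derivatives of the scalar coefficients contribute. -/
theorem dv_grad_N : dv (grad z (N z)) y =
    8 * ‖y - z‖ ^ 2 * (‖y - z‖ ^ 2 + inner ℝ z (y - z)) + 24 * ‖y‖ ^ 2 * ‖y - z‖ ^ 2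
      + 8 * omega y z ^ 2 + 8 * ‖y‖ ^ 2 * ‖z‖ ^ 2
      - 4 * (‖y‖ ^ 2 + ‖z‖ ^ 2) * (inner ℝ z (y - z) + ‖z‖ ^ 2) + 8 * inner ℝ z (y - z) ^ 2 := by
  have hT : Differentiable ℝ (T 3) := (contDiff_T 3 (n := 1)).differentiable one_ne_zero
  have hTz : DifferentiableAt ℝ (fun w => T 3 (w - z)) y :=
    (hT.comp (differentiable_id.sub_const z)) y
  have hw : DifferentiableAt ℝ (fun w : Plane => w - z) y := by fun_prop
  have hn : HasFDerivAt (fun w : Plane => ‖w‖ ^ 2) ((2 : ℝ) • innerSL ℝ y) y := by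
    simpa using hasFDerivAt_norm_sub_sq y 0
  have ho := hasFDerivAt_omega y z
  have hb : HasFDerivAt (fun w : Plane => (inner ℝ z (w - z) : ℝ)) (innerSL ℝ z) y := by
    have h := (innerSL ℝ z : Plane →L[ℝ] ℝ).hasFDerivAt.comp y ((hasFDerivAt_id y).sub_const z)
    exact h.congr_fderiv (by ext; simp)
  have h1 : HasFDerivAt (fun w => 4 * ‖w‖ ^ 2 * ‖w - z‖ ^ 2) _ y :=
    (hn.const_mul 4).mul (hasFDerivAt_norm_sub_sq y z)
  have h2 : HasFDerivAt (fun w => -8 * omega w z * ‖w‖ ^ 2) _ y := (ho.const_mul (-8)).mul hn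
  have h3 : HasFDerivAt (fun w => 4 * omega w z * (‖w‖ ^ 2 + ‖z‖ ^ 2)) _ y :=
    (ho.const_mul 4).mul (hn.add_const (‖z‖ ^ 2))
  have h4 : HasFDerivAt (fun w => -8 * omega w z * inner ℝ z (w - z)) _ y :=
    (ho.const_mul (-8)).mul hb
  have e : grad z (N z) = _ := funext fun y => grad_N z y
  rw [e, dv_add, dv_add, dv_add, dv_smul h1.differentiableAt hw,
    dv_smul h2.differentiableAt (differentiableAt_const _),
    dv_smul h3.differentiableAt (hT y), dv_smul h4.differentiableAt hTz,
    dv_sub_const (fun w => w), dv_sub_const, dv_id, dv_T_three, dv_T_three, dv_const,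
    h1.fderiv, h2.fderiv, h3.fderiv, h4.fderiv]
  · simp only [add_apply, smul_apply, neg_apply, innerSL_apply_apply, smul_eq_mul,
      inner_T_self z, inner_T_pole_T z y, inner_T_pole_T_sub z y, real_inner_self_eq_norm_sq,
      inner_self_sub z y, inner_self_T_pole z y, inner_self_T y, inner_pole_T_sub z y]
    ring
  · exact h1.differentiableAt.smul hw
  · exact h2.differentiableAt.smul (differentiableAt_const _)
  · exact (h1.differentiableAt.smul hw).add (h2.differentiableAt.smul (differentiableAt_const _))
  · exact h3.differentiableAt.smul (hT y)
  · exact ((h1.differentiableAt.smul hw).add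
      (h2.differentiableAt.smul (differentiableAt_const _))).add (h3.differentiableAt.smul (hT y))
  · exact h4.differentiableAt.smul hTz

/-- The weighted divergence of the gradient of `N`. -/
theorem wdv_grad_N (hy : y ≠ 0) : wdv (grad z (N z)) y = ‖y‖⁻¹ *
    (28 * ‖y - z‖ ^ 4 + 48 * ‖y - z‖ ^ 2 * inner ℝ z (y - z) + 28 * ‖y - z‖ ^ 2 * ‖z‖ ^ 2
      + 8 * omega y z ^ 2 * inner ℝ z (y - z) / ‖y‖ ^ 2) := by
  have hy' : ‖y‖ ≠ 0 := norm_ne_zero_iff.2 hy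
  rw [wdv, inner_grad_N, dv_grad_N]
  have h := norm_sq_expand z y
  have e : ‖y‖⁻¹ ^ 3 = ‖y‖⁻¹ * (‖y‖ ^ 2)⁻¹ := by field_simp
  have h0 : ‖y‖ ^ 2 ≠ 0 := by positivity
  rw [e, mul_assoc ‖y‖⁻¹ (‖y‖ ^ 2)⁻¹, ← mul_sub]
  congr 1
  generalize ‖y‖ ^ 2 = Y at *
  have h4 : ‖y - z‖ ^ 4 = (‖y - z‖ ^ 2) ^ 2 := by ring
  rw [h4]
  field_simp
  rw [h]
  ring

end Relations

/-! ### Functions of N, and elementary bounds for d and ω -/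

theorem wdv_grad_comp (z : Plane) {y : Plane} {g g' : ℝ → ℝ} {g'' : ℝ}
    (h1 : ∀ᶠ s in 𝓝 (N z y), HasDerivAt g (g' s) s) (h2 : HasDerivAt g' g'' (N z y)) :
    wdv (grad z (fun w => g (N z w))) y =
      g' (N z y) * wdv (grad z (N z)) y + g'' * ‖y‖⁻¹ * fderiv ℝ (N z) y (grad z (N z) y) := by
  have hN : ∀ w, DifferentiableAt ℝ (N z) w :=
    fun w => (contDiff_N z (n := 1)).differentiable one_ne_zero w
  have e : grad z (fun w => g (N z w)) =ᶠ[𝓝 y] fun w => g' (N z w) • grad z (N z) w := by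
    filter_upwards [(contDiff_N z (n := 0)).continuous.continuousAt.eventually h1] with w hw
    have h : HasFDerivAt (fun w => g (N z w)) _ w := hw.comp_hasFDerivAt w (hN w).hasFDerivAt
    simp only [grad, h.fderiv, Finset.smul_sum]
    refine Finset.sum_congr rfl fun j _ => ?_
    simp [smul_smul]
  have h3 : HasFDerivAt (fun w => g' (N z w)) _ y := h2.comp_hasFDerivAt y (hN y).hasFDerivAt
  rw [show wdv (grad z (fun w => g (N z w))) y = wdv (fun w => g' (N z w) • grad z (N z) w) y by
    rw [wdv, wdv, dv_congr e, e.eq_of_nhds]]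
  rw [wdv_smul h3.differentiableAt
    ((contDiff_grad z (contDiff_N z)).differentiable one_ne_zero y)]
  rw [h3.fderiv]
  simp
  ring

theorem N_nonneg (z y : Plane) : 0 ≤ N z y := by unfold N; positivity

theorem N_pos {z y : Plane} (h : y ≠ z) : 0 < N z y := by
  have : 0 < ‖y - z‖ := norm_pos_iff.2 (sub_ne_zero.2 h)
  unfold N; positivity

theorem d_eq_N (y z : Plane) : d y z = N z y ^ (1 / 4 : ℝ) := d_eq y z

theorem d_nonneg (y z : Plane) : 0 ≤ d y z := by
  rw [d_eq_N]; exact Real.rpow_nonneg (N_nonneg z y) _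

theorem d_pos {y z : Plane} (h : y ≠ z) : 0 < d y z := by
  rw [d_eq_N]; exact Real.rpow_pos_of_pos (N_pos h) _

theorem d_pow_four (y z : Plane) : d y z ^ 4 = N z y := by
  rw [d_eq_N, ← Real.rpow_natCast, ← Real.rpow_mul (N_nonneg z y)]; norm_num

theorem d_zpow (y z : Plane) (k : ℤ) : d y z ^ k = N z y ^ ((k : ℝ) / 4) := by
  rw [d_eq_N, ← Real.rpow_intCast, ← Real.rpow_mul (N_nonneg z y)]; congr 1; ring

theorem norm_sub_le_d (y z : Plane) : ‖y - z‖ ≤ d y z := by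
  refine le_of_pow_le_pow_left₀ (n := 4) (by norm_num) (d_nonneg y z) ?_
  rw [d_pow_four, N]
  nlinarith [sq_nonneg (omega y z)]

theorem abs_omega_le_d_sq (y z : Plane) : |omega y z| ≤ d y z ^ 2 / 2 := by
  refine abs_le_of_sq_le_sq ?_ (by positivity)
  have h := d_pow_four y z
  rw [N] at h
  nlinarith [norm_nonneg (y - z), pow_nonneg (norm_nonneg (y - z)) 4]

theorem norm_T_three (x : Plane) : ‖T 3 x‖ = ‖x‖ := by
  have h : ‖T 3 x‖ ^ 2 = ‖x‖ ^ 2 := by rw [← real_inner_self_eq_norm_sq, inner_T_self]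
  exact (pow_left_inj₀ (norm_nonneg _) (norm_nonneg _) two_ne_zero).1 h

/-- Up to sign, ω is the inner product of y - z with T_4(z), and equally with T_4(y), because T_4 is
skew and isometric. This is where the factor |z| in the estimate of f_z comes from. -/
theorem abs_omega_le_pole (y z : Plane) : |omega y z| ≤ ‖z‖ * ‖y - z‖ := by
  have h := abs_real_inner_le_norm (T 3 z) (y - z)
  rwa [inner_T_pole_sub, abs_neg, norm_T_three] at h

theorem abs_omega_le_self (y z : Plane) : |omega y z| ≤ ‖y‖ * ‖y - z‖ := by
  have h := abs_real_inner_le_norm (y - z) (T 3 y)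
  rwa [inner_sub_T, abs_neg, norm_T_three, mul_comm] at h

/-! ### The regularized kernel; formula and estimate for f_z -/

/-- The regularization `C⁻¹ (d⁴ + ε)^(-3/4)` of `Γ`. -/
def Gr (ε : ℝ) (z y : Plane) : ℝ := CHR⁻¹ * (N z y + ε) ^ (-(3 / 4) : ℝ)

theorem Gam_eq_Gr (z y : Plane) : Gam y z = Gr 0 z y := by
  rw [Gam, Gr, Q, d_zpow, add_zero]; norm_num

theorem hasDerivAt_rpow_add {s ε p : ℝ} (h : 0 < s + ε) (c : ℝ) :
    HasDerivAt (fun s => c * (s + ε) ^ p) (c * p * (s + ε) ^ (p - 1)) s := by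
  have h1 : HasDerivAt (fun s => s + ε) 1 s := (hasDerivAt_id s).add_const ε
  exact ((h1.rpow_const (p := p) (Or.inl h.ne')).const_mul c).congr_deriv (by ring)

theorem contDiffAt_Gr {ε : ℝ} {z y : Plane} (h : 0 < N z y + ε) {n : WithTop ℕ∞} :
    ContDiffAt ℝ n (Gr ε z) y := by
  unfold Gr
  exact contDiffAt_const.mul
    (((contDiff_N z).contDiffAt.add contDiffAt_const).rpow_const_of_ne h.ne')

theorem hasFDerivAt_Gr {ε : ℝ} {z y : Plane} (h : 0 < N z y + ε) :
    HasFDerivAt (Gr ε z)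
      ((-(3 / 4) * CHR⁻¹ * (N z y + ε) ^ (-(7 / 4) : ℝ)) • fderiv ℝ (N z) y) y := by
  have hN := ((contDiff_N z (n := 1)).differentiable one_ne_zero y).hasFDerivAt
  have := (hasDerivAt_rpow_add (p := -(3 / 4)) h CHR⁻¹).comp_hasFDerivAt y hN
  refine this.congr_fderiv ?_
  congr 1
  rw [show (-(3 / 4) - 1 : ℝ) = -(7 / 4) by norm_num]
  ring

theorem norm_mul_Lap_Gr {ε : ℝ} {z y : Plane} (hy : y ≠ 0) (h : 0 < N z y + ε) :
    ‖y‖ * Lap z (Gr ε z) y = CHR⁻¹ * (3 / 4 * (N z y + ε) ^ (-(7 / 4) : ℝ) * wdv (grad z (N z)) y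
      - 21 / 16 * (N z y + ε) ^ (-(11 / 4) : ℝ) * ‖y‖⁻¹
        * fderiv ℝ (N z) y (grad z (N z) y)) := by
  rw [norm_mul_Lap z hy (contDiffAt_Gr h)]
  have h1 : ∀ᶠ s in 𝓝 (N z y), HasDerivAt (fun s => CHR⁻¹ * (s + ε) ^ (-(3 / 4) : ℝ))
      ((fun s => CHR⁻¹ * -(3 / 4) * (s + ε) ^ (-(7 / 4) : ℝ)) s) s := by
    have : ∀ᶠ s in 𝓝 (N z y), 0 < s + ε :=
      (continuous_id.add continuous_const).continuousAt.eventually (lt_mem_nhds h)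
    filter_upwards [this] with s hs
    have := hasDerivAt_rpow_add (p := -(3 / 4)) hs CHR⁻¹
    rwa [show (-(3 / 4) - 1 : ℝ) = -(7 / 4) by norm_num] at this
  have h2 := hasDerivAt_rpow_add (p := -(7 / 4)) h (CHR⁻¹ * -(3 / 4))
  rw [show (-(7 / 4) - 1 : ℝ) = -(11 / 4) by norm_num] at h2
  have h3 := wdv_grad_comp z h1 h2
  change -wdv (grad z fun w => CHR⁻¹ * (N z w + ε) ^ (-(3 / 4) : ℝ)) y = _
  rw [h3]
  ring

theorem norm_mul_f {z y : Plane} (hy : y ≠ 0) (hz : y ≠ z) :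
    ‖y‖ * f z y = CHR⁻¹ * (3 / 4 * N z y ^ (-(7 / 4) : ℝ) * wdv (grad z (N z)) y
      - 21 / 16 * N z y ^ (-(11 / 4) : ℝ) * ‖y‖⁻¹ * fderiv ℝ (N z) y (grad z (N z) y)) := by
  have h := norm_mul_Lap_Gr (ε := 0) hy (by simpa using N_pos hz)
  simp only [add_zero] at h
  rw [← h, f]
  simp only [Gam_eq_Gr]

/-- The explicit expression of `f_z`. -/
theorem f_eq {z y : Plane} (hy : y ≠ 0) (hz : y ≠ z) :
    f z y = 3 * d y z ^ (-11 : ℤ) / (4 * CHR * ‖y‖ ^ 2) *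
        (-(7 / 4) * R13 y z + d y z ^ 4 * R23 y z + d y z ^ 4 * R33 y z
          - 112 * omega z y ^ 4) := by
  have hy' : ‖y‖ ≠ 0 := norm_ne_zero_iff.2 hy
  have hN := N_pos hz
  have h := norm_mul_f hy hz
  have h7 : N z y ^ (-(7 / 4) : ℝ) = d y z ^ (-11 : ℤ) * N z y := by
    rw [d_zpow, ← Real.rpow_add_one hN.ne']; norm_num
  have h11 : N z y ^ (-(11 / 4) : ℝ) = d y z ^ (-11 : ℤ) := by rw [d_zpow]; norm_num
  rw [h7, h11, wdv_grad_N z y hy, fderiv_N_grad_N] at h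
  have h4 : ‖y - z‖ ^ 4 = N z y - 4 * omega y z ^ 2 := by rw [N]; ring
  have e1 := norm_sq_expand z y
  -- Expanding |y|² about z makes 28|y-z|⁴ and 28|y-z|²|z|² cancel against (7/4)·16 |y|²|y-z|². The
  -- only other relation used is |y-z|⁴ = N - 4ω².
  have key : N z y * (28 * ‖y - z‖ ^ 4 + 48 * ‖y - z‖ ^ 2 * inner ℝ z (y - z)
        + 28 * ‖y - z‖ ^ 2 * ‖z‖ ^ 2 + 8 * omega y z ^ 2 * inner ℝ z (y - z) / ‖y‖ ^ 2)
      - 7 / 4 * (16 * ‖y‖ ^ 2 * ‖y - z‖ ^ 2 * N z y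
        - 16 * omega y z ^ 2 * ‖y - z‖ ^ 2 * (‖y - z‖ ^ 2 + 4 * inner ℝ z (y - z)))
      = -(7 / 4) * R13 y z + d y z ^ 4 * R23 y z + d y z ^ 4 * R33 y z
          - 112 * omega z y ^ 4 := by
    rw [R13, R23, R33, d_pow_four, omega_swap y z]
    have h0 : ‖y‖ ^ 2 ≠ 0 := by positivity
    have e2 : (16 * ‖y‖ ^ 2 * ‖y - z‖ ^ 2 * N z y) =
        16 * (‖y - z‖ ^ 2 + 2 * inner ℝ z (y - z) + ‖z‖ ^ 2) * ‖y - z‖ ^ 2 * N z y := by rw [e1]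
    rw [e2, h4]
    have h4' : (‖y - z‖ ^ 2) ^ 2 = N z y - 4 * omega y z ^ 2 := by rw [← h4]; ring
    generalize ‖y - z‖ ^ 2 = a at *
    generalize ‖y‖ ^ 2 = Y at *
    generalize N z y = n at *
    field_simp
    linear_combination (-112 * n + 112 * omega y z ^ 2) * Y * h4'
  rw [← key]
  refine mul_left_cancel₀ hy' ?_
  rw [h]
  -- The identity does not need C ≠ 0: for C = 0 both sides vanish because the inverse of zero is
  -- zero.
  by_cases hC : CHR = 0
  · simp [hC]
  field_simp
  ring

theorem abs_f_le {z y : Plane} (hy : y ≠ 0) (hz : y ≠ z) :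
    |f z y| ≤ 105 * |CHR⁻¹| * ‖z‖ * ‖y‖⁻¹ ^ 2 * d y z ^ (-4 : ℤ) := by
  have hy' : 0 < ‖y‖ := norm_pos_iff.2 hy
  have hd := d_pos hz
  have hw := norm_sub_le_d y z
  have hw0 := norm_nonneg (y - z)
  have hz0 := norm_nonneg z
  have ho1 := abs_omega_le_d_sq y z
  have ho2 : |omega y z| ≤ ‖z‖ * d y z := (abs_omega_le_pole y z).trans (by gcongr)
  have ho3 : |omega y z| ≤ ‖y‖ * d y z := (abs_omega_le_self y z).trans (by gcongr)
  have hb : |(inner ℝ z (y - z) : ℝ)| ≤ ‖z‖ * d y z :=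
    (abs_real_inner_le_norm _ _).trans (by gcongr)
  -- One factor is bounded by |z| d and the other by d²/2, so that exactly one power of |z| appears.
  have hosq : omega y z ^ 2 ≤ ‖z‖ * d y z ^ 3 / 2 := by
    rw [← sq_abs, sq]
    calc |omega y z| * |omega y z| ≤ (‖z‖ * d y z) * (d y z ^ 2 / 2) := by gcongr
      _ = _ := by ring
  -- The bound by |y| d absorbs the additional |y|⁻² in the last term of `R33`.
  have hosq' : omega y z ^ 2 / ‖y‖ ^ 2 ≤ d y z ^ 2 := by
    rw [div_le_iff₀ (by positivity), ← sq_abs]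
    calc |omega y z| ^ 2 ≤ (‖y‖ * d y z) ^ 2 := by gcongr
      _ = _ := by ring
  have hosq4 : omega y z ^ 2 ≤ d y z ^ 4 / 4 := by
    rw [← sq_abs]
    calc |omega y z| ^ 2 ≤ (d y z ^ 2 / 2) ^ 2 := by gcongr
      _ = _ := by ring
  have b1 : |-(7 / 4) * R13 y z| ≤ 56 * ‖z‖ * d y z ^ 7 := by
    rw [R13, abs_mul, abs_mul, abs_mul, abs_mul, abs_of_nonneg (by positivity : 0 ≤ ‖y - z‖ ^ 2),
      abs_of_nonneg (by positivity : 0 ≤ ‖y - z‖ ^ 4 + d y z ^ 4)]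
    norm_num
    calc 7 / 4 * (16 * (‖y - z‖ ^ 4 + d y z ^ 4) * ‖y - z‖ ^ 2 * |inner ℝ z (y - z)|)
        ≤ 7 / 4 * (16 * (d y z ^ 4 + d y z ^ 4) * d y z ^ 2 * (‖z‖ * d y z)) := by gcongr
      _ = _ := by ring
  have b2 : |d y z ^ 4 * R23 y z| ≤ 38 * ‖z‖ * d y z ^ 7 := by
    rw [R23, abs_mul, abs_of_nonneg (by positivity : 0 ≤ d y z ^ 4), omega_swap y z, neg_sq]
    calc d y z ^ 4 * |4 * omega y z ^ 2 + 36 * ‖y - z‖ ^ 2 * inner ℝ z (y - z)|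
        ≤ d y z ^ 4 * (4 * omega y z ^ 2 + 36 * ‖y - z‖ ^ 2 * |inner ℝ z (y - z)|) := by
          gcongr
          refine (abs_add_le _ _).trans (add_le_add (abs_of_nonneg (by positivity)).le ?_)
          rw [abs_mul, abs_of_nonneg (by positivity : 0 ≤ 36 * ‖y - z‖ ^ 2)]
      _ ≤ d y z ^ 4 * (4 * (‖z‖ * d y z ^ 3 / 2) + 36 * d y z ^ 2 * (‖z‖ * d y z)) := by gcongr
      _ = _ := by ring
  have b3 : |d y z ^ 4 * R33 y z| ≤ 32 * ‖z‖ * d y z ^ 7 := by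
    rw [R33, abs_mul, abs_of_nonneg (by positivity : 0 ≤ d y z ^ 4), omega_swap y z, neg_sq]
    calc d y z ^ 4 * |12 * ‖y - z‖ ^ 2 * inner ℝ z (y - z) + 24 * omega y z ^ 2
          + 8 / ‖y‖ ^ 2 * inner ℝ z (y - z) * omega y z ^ 2|
        ≤ d y z ^ 4 * (12 * ‖y - z‖ ^ 2 * |inner ℝ z (y - z)| + 24 * omega y z ^ 2
          + 8 * |inner ℝ z (y - z)| * (omega y z ^ 2 / ‖y‖ ^ 2)) := by
          gcongr
          refine (abs_add_le _ _).trans (add_le_add ((abs_add_le _ _).trans (add_le_add ?_ ?_)) ?_)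
          · rw [abs_mul, abs_of_nonneg (by positivity : 0 ≤ 12 * ‖y - z‖ ^ 2)]
          · exact (abs_of_nonneg (by positivity)).le
          · rw [abs_mul, abs_mul, abs_of_nonneg (by positivity : 0 ≤ 8 / ‖y‖ ^ 2),
              abs_of_nonneg (by positivity : 0 ≤ omega y z ^ 2)]
            exact le_of_eq (by ring)
      _ ≤ d y z ^ 4 * (12 * d y z ^ 2 * (‖z‖ * d y z) + 24 * (‖z‖ * d y z ^ 3 / 2)
          + 8 * (‖z‖ * d y z) * d y z ^ 2) := by gcongr
      _ = _ := by ring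
  have b4 : |112 * omega z y ^ 4| ≤ 14 * ‖z‖ * d y z ^ 7 := by
    rw [omega_swap y z, abs_of_nonneg (by positivity)]
    calc 112 * (-omega y z) ^ 4 = 112 * (omega y z ^ 2 * omega y z ^ 2) := by ring
      _ ≤ 112 * ((‖z‖ * d y z ^ 3 / 2) * (d y z ^ 4 / 4)) := by gcongr
      _ = _ := by ring
  rw [f_eq hy hz, abs_mul]
  -- 140 = 56 + 38 + 32 + 14; with the prefactor 3/4 this gives the constant 105.
  have hbr : |-(7 / 4) * R13 y z + d y z ^ 4 * R23 y z + d y z ^ 4 * R33 y z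
      - 112 * omega z y ^ 4| ≤ 140 * ‖z‖ * d y z ^ 7 := by
    refine (abs_sub _ _).trans ?_
    have := abs_add_le (-(7 / 4) * R13 y z + d y z ^ 4 * R23 y z) (d y z ^ 4 * R33 y z)
    have := abs_add_le (-(7 / 4) * R13 y z) (d y z ^ 4 * R23 y z)
    linarith
  have hpre : |3 * d y z ^ (-11 : ℤ) / (4 * CHR * ‖y‖ ^ 2)|
      = 3 / 4 * |CHR⁻¹| * ‖y‖⁻¹ ^ 2 * d y z ^ (-11 : ℤ) := by
    rw [abs_div, abs_mul, abs_mul, abs_mul, abs_of_nonneg (by positivity : 0 ≤ ‖y‖ ^ 2),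
      abs_of_nonneg (by positivity : 0 ≤ d y z ^ (-11 : ℤ)), abs_inv, inv_pow]
    norm_num
    ring
  have hd11 : d y z ^ (-11 : ℤ) * d y z ^ 7 = d y z ^ (-4 : ℤ) := by
    rw [← zpow_natCast, ← zpow_add₀ hd.ne']; norm_num
  rw [hpre, ← hd11]
  calc 3 / 4 * |CHR⁻¹| * ‖y‖⁻¹ ^ 2 * d y z ^ (-11 : ℤ) * _
      ≤ 3 / 4 * |CHR⁻¹| * ‖y‖⁻¹ ^ 2 * d y z ^ (-11 : ℤ) * (140 * ‖z‖ * d y z ^ 7) := by gcongr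
    _ = _ := by ring

theorem exists_abs_f_le : ∃ C : ℝ, 0 < C ∧ ∀ z y : Plane, y ≠ 0 → y ≠ z →
      |f z y| ≤ C * ((√(‖z‖ * ‖y‖) + ‖z‖) / ‖y‖ ^ 2) * d y z ^ (-Q + 1) := by
  -- The bound already proved has |z| alone, so the square root is only added for free; the 1 makes
  -- the constant visibly positive.
  refine ⟨105 * |CHR⁻¹| + 1, by positivity, fun z y hy hz => (abs_f_le hy hz).trans ?_⟩
  have hd := d_pos hz
  rw [show -Q + 1 = -4 from rfl]
  refine mul_le_mul_of_nonneg_right ?_ (by positivity)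
  calc 105 * |CHR⁻¹| * ‖z‖ * ‖y‖⁻¹ ^ 2 ≤ (105 * |CHR⁻¹| + 1) * (√(‖z‖ * ‖y‖) + ‖z‖) * ‖y‖⁻¹ ^ 2 := by
        gcongr
        · linarith
        · linarith [Real.sqrt_nonneg (‖z‖ * ‖y‖)]
    _ = _ := by rw [inv_pow]; ring

/-! ### Splitting of the regularized Laplacian and bounds for its pieces -/

/-- The error term in the expansion of `Δ_z` of the regularization. -/
def err (z y : Plane) : ℝ :=
  ‖y‖⁻¹ * (omega y z ^ 2 / N z y) * ‖y - z‖ ^ 2 * (‖y - z‖ ^ 2 + 4 * inner ℝ z (y - z))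

/-- After multiplying f_z by (N/(N+ε))^(7/4) the divergence terms agree, and the gradient terms
differ by the factor 1/N - 1/(N+ε) = ε/(N(N+ε)). The constant 21 is 16 · 21/16. -/
theorem norm_mul_Lap_Gr_eq {ε : ℝ} (hε : 0 < ε) {z y : Plane} (hy : y ≠ 0) (hz : y ≠ z) :
    ‖y‖ * Lap z (Gr ε z) y = (N z y / (N z y + ε)) ^ (7 / 4 : ℝ) * (‖y‖ * f z y)
      + 21 * CHR⁻¹ * (ε * (N z y + ε) ^ (-(11 / 4) : ℝ)) * (‖y‖ * ‖y - z‖ ^ 2 - err z y) := by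
  have hN := N_pos hz
  have hNe : 0 < N z y + ε := by positivity
  have hy' : ‖y‖ ≠ 0 := norm_ne_zero_iff.2 hy
  rw [norm_mul_Lap_Gr hy hNe, norm_mul_f hy hz, Real.div_rpow hN.le hNe.le, err]
  have hS : ‖y‖ * ‖y - z‖ ^ 2 - ‖y‖⁻¹ * (omega y z ^ 2 / N z y) * ‖y - z‖ ^ 2
      * (‖y - z‖ ^ 2 + 4 * inner ℝ z (y - z))
      = fderiv ℝ (N z) y (grad z (N z) y) / (16 * N z y * ‖y‖) := by
    rw [fderiv_N_grad_N]
    field_simp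
  rw [hS]
  have e1 : N z y ^ (-(7 / 4) : ℝ) = (N z y ^ (7 / 4 : ℝ))⁻¹ := Real.rpow_neg hN.le _
  have e2 : (N z y + ε) ^ (-(7 / 4) : ℝ) = ((N z y + ε) ^ (7 / 4 : ℝ))⁻¹ := Real.rpow_neg hNe.le _
  have e3 : N z y ^ (-(11 / 4) : ℝ) = (N z y ^ (7 / 4 : ℝ))⁻¹ / N z y := by
    rw [← e1, ← Real.rpow_sub_one hN.ne']; norm_num
  have e4 : (N z y + ε) ^ (-(11 / 4) : ℝ) = ((N z y + ε) ^ (7 / 4 : ℝ))⁻¹ / (N z y + ε) := by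
    rw [← e2, ← Real.rpow_sub_one hNe.ne']; norm_num
  rw [e1, e2, e3, e4]
  have h1 : 0 < N z y ^ (7 / 4 : ℝ) := Real.rpow_pos_of_pos hN _
  have h2 : 0 < (N z y + ε) ^ (7 / 4 : ℝ) := Real.rpow_pos_of_pos hNe _
  field_simp
  ring

/-- Each (V_j N)² is at most the whole sum of squares, which is O(d⁶) locally. Hence the derivatives
of Γ along V_j are O(d⁻⁴). -/
theorem abs_along_N_le (z y : Plane) (j : Fin 4) :
    |fderiv ℝ (N z) y (V z j y)| ≤ 4 * d y z ^ 3 * (‖y‖ + ‖y - z‖ + ‖z‖) := by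
  have hd := d_nonneg y z
  have hw := norm_sub_le_d y z
  refine abs_le_of_sq_le_sq ?_ (by positivity)
  have h1 : fderiv ℝ (N z) y (V z j y) ^ 2 ≤ fderiv ℝ (N z) y (grad z (N z) y) := by
    simp only [grad, map_sum, map_smul, smul_eq_mul, ← sq]
    exact Finset.single_le_sum (f := fun j => fderiv ℝ (N z) y (V z j y) ^ 2)
      (fun _ _ => sq_nonneg _) (Finset.mem_univ j)
  refine h1.trans ?_
  have hosq4 : omega y z ^ 2 ≤ d y z ^ 4 / 4 := by
    rw [← sq_abs]
    calc |omega y z| ^ 2 ≤ (d y z ^ 2 / 2) ^ 2 := by gcongr; exact abs_omega_le_d_sq y z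
      _ = _ := by ring
  have hb : -(inner ℝ z (y - z) : ℝ) ≤ ‖z‖ * ‖y - z‖ :=
    (neg_le_abs _).trans (abs_real_inner_le_norm _ _)
  rw [fderiv_N_grad_N, ← d_pow_four]
  calc 16 * ‖y‖ ^ 2 * ‖y - z‖ ^ 2 * d y z ^ 4
        - 16 * omega y z ^ 2 * ‖y - z‖ ^ 2 * (‖y - z‖ ^ 2 + 4 * inner ℝ z (y - z))
      = 16 * ‖y‖ ^ 2 * ‖y - z‖ ^ 2 * d y z ^ 4
        + 64 * omega y z ^ 2 * ‖y - z‖ ^ 2 * (-(inner ℝ z (y - z)))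
        - 16 * omega y z ^ 2 * ‖y - z‖ ^ 2 * ‖y - z‖ ^ 2 := by ring
    _ ≤ 16 * ‖y‖ ^ 2 * ‖y - z‖ ^ 2 * d y z ^ 4
        + 64 * omega y z ^ 2 * ‖y - z‖ ^ 2 * (‖z‖ * ‖y - z‖) - 0 := by
        gcongr
        positivity
    _ ≤ 16 * ‖y‖ ^ 2 * d y z ^ 2 * d y z ^ 4
        + 64 * (d y z ^ 4 / 4) * d y z ^ 2 * (‖z‖ * ‖y - z‖) - 0 := by gcongr
    _ = 16 * d y z ^ 6 * (‖y‖ ^ 2 + ‖z‖ * ‖y - z‖) := by ring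
    _ ≤ 16 * d y z ^ 6 * (‖y‖ + ‖y - z‖ + ‖z‖) ^ 2 := by
        gcongr
        nlinarith [norm_nonneg y, norm_nonneg z, norm_nonneg (y - z),
          mul_nonneg (norm_nonneg z) (norm_nonneg (y - z)),
          mul_nonneg (norm_nonneg y) (norm_nonneg (y - z)),
          mul_nonneg (norm_nonneg z) (norm_nonneg y)]
    _ = _ := by ring

/-- By ω² ≤ N and Cauchy-Schwarz the error has order |y-z|³, one more than the main term |y| |y-z|²;
this gain makes it negligible in the limit. -/
theorem abs_err_le {z y : Plane} (hz : y ≠ z) :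
    |err z y| ≤ ‖y‖⁻¹ * ‖y - z‖ ^ 3 * (‖y - z‖ + 4 * ‖z‖) := by
  have hN := N_pos hz
  have h1 : omega y z ^ 2 / N z y ≤ 1 := by
    rw [div_le_one hN, N]
    nlinarith [sq_nonneg (omega y z), pow_nonneg (norm_nonneg (y - z)) 4]
  have h2 : |‖y - z‖ ^ 2 + 4 * (inner ℝ z (y - z) : ℝ)|
      ≤ ‖y - z‖ ^ 2 + 4 * (‖z‖ * ‖y - z‖) := by
    refine (abs_add_le _ _).trans (add_le_add (abs_of_nonneg (by positivity)).le ?_)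
    rw [abs_mul, abs_of_nonneg (by norm_num : (0 : ℝ) ≤ 4)]
    gcongr
    exact abs_real_inner_le_norm _ _
  rw [err, abs_mul, abs_of_nonneg (by positivity)]
  calc ‖y‖⁻¹ * (omega y z ^ 2 / N z y) * ‖y - z‖ ^ 2
        * |‖y - z‖ ^ 2 + 4 * (inner ℝ z (y - z) : ℝ)|
      ≤ ‖y‖⁻¹ * 1 * ‖y - z‖ ^ 2 * (‖y - z‖ ^ 2 + 4 * (‖z‖ * ‖y - z‖)) := by gcongr
    _ = _ := by ring

/-! ### Affine changes of variables -/

section ChangeOfVariables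

open scoped ENNReal

/-- The linear map of the plane with matrix `M`. -/
def lin (M : Matrix (Fin 4) (Fin 4) ℝ) : Plane →L[ℝ] Plane :=
  LinearMap.toContinuousLinearMap (Matrix.toEuclideanLin M)

theorem lin_apply (M : Matrix (Fin 4) (Fin 4) ℝ) (x : Plane) (i : Fin 4) :
    lin M x i = ∑ j, M i j * x j := by
  simp [lin, Matrix.mulVec, dotProduct]

theorem det_lin (M : Matrix (Fin 4) (Fin 4) ℝ) : (lin M).det = M.det := by
  rw [lin, ContinuousLinearMap.det]
  exact LinearMap.det_toLpLin 2 M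

variable {M : Matrix (Fin 4) (Fin 4) ℝ}

theorem bijective_add_lin (hM : M.det ≠ 0) (z : Plane) :
    Function.Bijective fun x => z + lin M x := by
  have h : IsUnit (LinearMap.det (Matrix.toEuclideanLin M)) := by
    rw [LinearMap.det_toLpLin]; exact hM.isUnit
  have h2 : Function.Bijective (lin M) :=
    (Module.End.isUnit_iff _).1 ((LinearMap.isUnit_iff_isUnit_det _).2 h)
  exact (AddGroup.addLeft_bijective z).comp h2

theorem hasFDerivWithinAt_add_lin (z x : Plane) (s : Set Plane) :
    HasFDerivWithinAt (fun x => z + lin M x) (lin M) s x :=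
  ((lin M).hasFDerivAt.const_add z).hasFDerivWithinAt

theorem integral_comp_add_lin (hM : M.det ≠ 0) (z : Plane) (g : Plane → ℝ) :
    ∫ y, g y = |M.det| * ∫ x, g (z + lin M x) := by
  have hb := bijective_add_lin hM z
  have h := integral_image_eq_integral_abs_det_fderiv_smul volume MeasurableSet.univ
    (fun x _ => hasFDerivWithinAt_add_lin (M := M) z x Set.univ) hb.injective.injOn g
  rw [Set.image_univ, hb.surjective.range_eq] at h
  simpa [det_lin, integral_const_mul] using h

theorem lintegral_comp_add_lin (hM : M.det ≠ 0) (z : Plane) (g : Plane → ℝ≥0∞) :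
    ∫⁻ y, g y = ENNReal.ofReal |M.det| * ∫⁻ x, g (z + lin M x) := by
  have hb := bijective_add_lin hM z
  have h := lintegral_image_eq_lintegral_abs_det_fderiv_mul volume MeasurableSet.univ
    (fun x _ => hasFDerivWithinAt_add_lin (M := M) z x Set.univ) hb.injective.injOn g
  rw [Set.image_univ, hb.surjective.range_eq] at h
  simp only [Measure.restrict_univ, det_lin] at h
  rw [h, lintegral_const_mul' _ _ ENNReal.ofReal_ne_top]

end ChangeOfVariables

/-! ### Integrals determined by power-law sublevel sets -/

section LayerCake

open scoped ENNReal

/-- If the sublevel sets of `n` have measure `V s ^ p`, then `∫ (1 + n) ^ (-(p + 1)) = V`. -/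
theorem lintegral_one_add_rpow {α : Type*} [MeasurableSpace α] {μ : Measure α} {n : α → ℝ}
    (hn : ∀ x, 0 ≤ n x) (hm : Measurable n) {p : ℝ} (hp : 0 < p) {W : ℝ≥0∞}
    (h : ∀ s > 0, μ {x | n x ≤ s} = ENNReal.ofReal (s ^ p) * W) :
    ∫⁻ x, ENNReal.ofReal ((1 + n x) ^ (-(p + 1))) ∂μ = W := by
  have h1 : ∀ x, (1 + n x) ^ (-(p + 1)) = ((1 + n x)⁻¹) ^ (p + 1) := fun x => by
    rw [Real.rpow_neg (by linarith [hn x]), Real.inv_rpow (by linarith [hn x])]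
  simp only [h1]
  rw [lintegral_rpow_eq_lintegral_meas_le_mul μ
    (Eventually.of_forall fun x => inv_nonneg.2 (by linarith [hn x]))
    (by fun_prop) (by linarith : 0 < p + 1)]
  -- The superlevel set at height t < 1 is {n ≤ 1/t - 1}, and (1/t - 1)^p t^p = (1 - t)^p. The
  -- integral of this over (0, 1) is 1/(p+1), which cancels the layer cake factor p + 1.
  have h2 : ∫⁻ t in Set.Ioi 0, μ {a | t ≤ (1 + n a)⁻¹} * ENNReal.ofReal (t ^ (p + 1 - 1))
      = ∫⁻ t in Set.Ioo (0 : ℝ) 1, ENNReal.ofReal ((1 - t) ^ p) * W := by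
    rw [← lintegral_indicator measurableSet_Ioi, ← lintegral_indicator measurableSet_Ioo]
    refine lintegral_congr_ae ?_
    have hne : ∀ᵐ t : ℝ, t ≠ 1 := by simp [ae_iff]
    filter_upwards [hne] with t ht
    by_cases h0 : 0 < t
    · rw [Set.indicator_of_mem (Set.mem_Ioi.2 h0)]
      rcases lt_or_gt_of_ne ht with h1 | h1
      · rw [Set.indicator_of_mem (show t ∈ Set.Ioo (0 : ℝ) 1 from ⟨h0, h1⟩)]
        have hs : {a | t ≤ (1 + n a)⁻¹} = {a | n a ≤ t⁻¹ - 1} := by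
          ext a
          simp only [Set.mem_ofPred_eq]
          rw [le_inv_comm₀ h0 (by linarith [hn a])]
          constructor <;> intro <;> linarith
        have hs0 : 0 < t⁻¹ - 1 := by
          have := (one_lt_inv₀ h0).2 h1
          linarith
        rw [hs, h _ hs0, mul_right_comm, ← ENNReal.ofReal_mul (by positivity), add_sub_cancel_right,
          ← Real.mul_rpow hs0.le h0.le]
        congr 3
        field_simp
      · rw [Set.indicator_of_notMem (fun hh => by linarith [hh.2])]
        have hs : {a | t ≤ (1 + n a)⁻¹} = ∅ := by
          ext a
          simp only [Set.mem_ofPred_eq, Set.mem_empty_iff_false, iff_false, not_le]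
          exact lt_of_le_of_lt (inv_le_one_of_one_le₀ (by linarith [hn a])) h1
        simp [hs]
    · rw [Set.indicator_of_notMem (by simpa using h0),
        Set.indicator_of_notMem (fun hh => h0 hh.1)]
  rw [h2, lintegral_mul_const _ (by fun_prop)]
  have h3 : ∫⁻ t in Set.Ioo (0 : ℝ) 1, ENNReal.ofReal ((1 - t) ^ p)
      = ENNReal.ofReal (1 / (p + 1)) := by
    rw [← ofReal_integral_eq_lintegral_ofReal, ← integral_Ioc_eq_integral_Ioo,
      ← intervalIntegral.integral_of_le zero_le_one]
    · congr 1
      rw [intervalIntegral.integral_comp_sub_left (fun x => x ^ p) 1,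
        integral_rpow (Or.inl (by linarith))]
      simp [Real.zero_rpow (by linarith : p + 1 ≠ 0)]
    · have : Continuous fun t : ℝ => (1 - t) ^ p :=
        (continuous_const.sub continuous_id).rpow_const fun _ => Or.inr hp.le
      exact (this.integrableOn_Icc).mono_set Set.Ioo_subset_Icc_self
    · filter_upwards [ae_restrict_mem measurableSet_Ioo] with t ht
      exact Real.rpow_nonneg (by linarith [ht.2]) _
  rw [h3, ← mul_assoc, ← ENNReal.ofReal_mul (by linarith)]
  rw [mul_one_div_cancel (by linarith), ENNReal.ofReal_one, one_mul]

/-- If the sublevel sets of `n` have measure `V s ^ p` with `p > 1`, then `1 / n` is integrable on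
the first one. -/
theorem lintegral_inv_lt_top {α : Type*} [MeasurableSpace α] {μ : Measure α} {n : α → ℝ}
    (hn : ∀ x, 0 ≤ n x) (hm : Measurable n) {p : ℝ} (hp : 1 < p) {W : ℝ≥0∞} (hW : W ≠ ⊤)
    (h : ∀ s > 0, μ {x | n x ≤ s} = ENNReal.ofReal (s ^ p) * W) :
    ∫⁻ x in {x | n x ≤ 1}, ENNReal.ofReal (n x)⁻¹ ∂μ < ⊤ := by
  rw [lintegral_eq_lintegral_meas_le _ (Eventually.of_forall fun x => inv_nonneg.2 (hn x))
    (by fun_prop), ← Set.Ioc_union_Ioi_eq_Ioi zero_le_one]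
  -- Heights up to 1 contribute at most the total mass W; above 1 the superlevel sets have mass at
  -- most t^(-p) W, integrable because p > 1.
  refine (lintegral_union_le _ _ _).trans_lt (ENNReal.add_lt_top.2 ⟨?_, ?_⟩)
  · calc ∫⁻ t in Set.Ioc (0 : ℝ) 1, (μ.restrict {x | n x ≤ 1}) {a | t ≤ (n a)⁻¹}
        ≤ ∫⁻ t in Set.Ioc (0 : ℝ) 1, W := by
          refine lintegral_mono fun t => (measure_mono (Set.subset_univ _)).trans ?_
          rw [Measure.restrict_apply_univ, h 1 one_pos]
          simp
      _ < ⊤ := by simp [hW.lt_top]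
  · calc ∫⁻ t in Set.Ioi (1 : ℝ), (μ.restrict {x | n x ≤ 1}) {a | t ≤ (n a)⁻¹}
        ≤ ∫⁻ t in Set.Ioi (1 : ℝ), ENNReal.ofReal (t ^ (-p)) * W := by
          refine setLIntegral_mono' measurableSet_Ioi fun t ht => ?_
          have ht0 : 0 < t := zero_lt_one.trans ht
          rw [Real.rpow_neg ht0.le, ← Real.inv_rpow ht0.le, ← h _ (inv_pos.2 ht0)]
          refine (Measure.restrict_apply_le _ _).trans (measure_mono fun a ha => ?_)
          have ha' : t ≤ (n a)⁻¹ := ha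
          have h0 : 0 < n a := inv_pos.1 (ht0.trans_le ha')
          exact (le_inv_comm₀ ht0 h0).1 ha'
      _ < ⊤ := by
          rw [lintegral_mul_const _ (by fun_prop)]
          exact ENNReal.mul_lt_top
            ((integrableOn_Ioi_rpow_of_lt (by linarith) one_pos).lintegral_lt_top) hW.lt_top

end LayerCake

/-! ### The model ℍ × ℝ and the blow-up at the pole -/

section Model

open scoped ENNReal

/-- The square of the horizontal norm in the model `ℍ × ℝ`. -/
def hor (x : Plane) : ℝ := x 0 ^ 2 + x 1 ^ 2 + x 3 ^ 2

/-- The fourth power of the gauge of the model `ℍ × ℝ`. -/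
def gauge (x : Plane) : ℝ := hor x ^ 2 + 4 * x 2 ^ 2

/-- The matrix of the dilations of the model. -/
def dil (t : ℝ) : Matrix (Fin 4) (Fin 4) ℝ := Matrix.diagonal ![t, t, t ^ 2, t]

theorem det_dil (t : ℝ) : (dil t).det = t ^ 5 := by
  simp [dil, Matrix.det_diagonal, Fin.prod_univ_four]; ring

theorem hor_nonneg (x : Plane) : 0 ≤ hor x := by unfold hor; positivity

theorem gauge_nonneg (x : Plane) : 0 ≤ gauge x := by unfold gauge; positivity

theorem gauge_pos {x : Plane} (hx : x ≠ 0) : 0 < gauge x := by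
  refine (gauge_nonneg x).lt_of_ne' fun h => hx ?_
  have h0 := hor_nonneg x
  rw [gauge] at h
  have h1 : hor x = 0 := by nlinarith [sq_nonneg (x 2), sq_nonneg (hor x)]
  have h2 : x 2 ^ 2 = 0 := by nlinarith [sq_nonneg (x 2), sq_nonneg (hor x)]
  have h3 := norm_sq_eq x
  rw [hor] at h1
  rw [← norm_eq_zero, ← sq_eq_zero_iff]
  linarith

theorem continuous_hor : Continuous hor := by unfold hor; fun_prop

theorem continuous_gauge : Continuous gauge := by unfold gauge hor; fun_prop

theorem dil_apply (t : ℝ) (x : Plane) (i : Fin 4) :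
    lin (dil t) x i = ![t, t, t ^ 2, t] i * x i := by
  simp [lin_apply, dil, Matrix.diagonal_apply]

theorem hor_dil (t : ℝ) (x : Plane) : hor (lin (dil t) x) = t ^ 2 * hor x := by
  simp [hor, dil_apply]; ring

theorem gauge_dil (t : ℝ) (x : Plane) : gauge (lin (dil t) x) = t ^ 4 * gauge x := by
  simp [gauge, hor_dil, dil_apply]; ring

/-- Scaling by the dilation with t = s^(1/4): the Jacobian contributes t⁵ and the homogeneous
density t^k. The cases used are k = 0 (volume) and k = 2 (density `hor`). -/
theorem withDensity_gauge_le {ρ : Plane → ℝ≥0∞} (k : ℕ)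
    (hρ : ∀ t > 0, ∀ x, ρ (lin (dil t) x) = ENNReal.ofReal (t ^ k) * ρ x) {s : ℝ} (hs : 0 < s) :
    (volume.withDensity ρ) {x | gauge x ≤ s} = ENNReal.ofReal (s ^ ((5 + k : ℝ) / 4))
      * ∫⁻ x in {x | gauge x ≤ 1}, ρ x := by
  have hm : ∀ s, MeasurableSet {x | gauge x ≤ s} := fun s =>
    measurableSet_le continuous_gauge.measurable measurable_const
  set t := s ^ (1 / 4 : ℝ) with ht
  have ht0 : 0 < t := Real.rpow_pos_of_pos hs _
  have ht4 : t ^ 4 = s := by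
    rw [ht, ← Real.rpow_natCast, ← Real.rpow_mul hs.le]; norm_num
  rw [withDensity_apply _ (hm s), ← lintegral_indicator (hm s), ← lintegral_indicator (hm 1),
    lintegral_comp_add_lin (M := dil t) (by rw [det_dil]; positivity) 0,
    ← lintegral_const_mul' _ _ ENNReal.ofReal_ne_top,
    ← lintegral_const_mul' _ _ ENNReal.ofReal_ne_top]
  refine lintegral_congr fun x => ?_
  have hiff : gauge (0 + lin (dil t) x) ≤ s ↔ gauge x ≤ 1 := by
    rw [zero_add, gauge_dil, ht4, mul_le_iff_le_one_right hs]
  by_cases hx : gauge x ≤ 1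
  · rw [Set.indicator_of_mem (show _ ∈ {x | gauge x ≤ s} from hiff.2 hx),
      Set.indicator_of_mem (show x ∈ {x | gauge x ≤ 1} from hx), zero_add, hρ t ht0, ← mul_assoc,
      det_dil, abs_of_pos (by positivity), ← ENNReal.ofReal_mul (by positivity), ← pow_add]
    congr 2
    rw [ht, ← Real.rpow_natCast, ← Real.rpow_mul hs.le]
    congr 1
    push_cast
    ring
  · rw [Set.indicator_of_notMem (show _ ∉ {x | gauge x ≤ s} from fun h => hx (hiff.1 h)),
      Set.indicator_of_notMem (show x ∉ {x | gauge x ≤ 1} from hx)]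
    simp

theorem norm_le_of_gauge_le {x : Plane} (h : gauge x ≤ 1) : ‖x‖ ≤ 2 := by
  refine le_of_pow_le_pow_left₀ two_ne_zero two_pos.le ?_
  rw [norm_sq_eq]
  have h1 := hor_nonneg x
  rw [gauge] at h
  have h2 : hor x ≤ 1 := by nlinarith [sq_nonneg (x 2)]
  have h3 : x 2 ^ 2 ≤ 1 := by nlinarith [sq_nonneg (hor x)]
  rw [hor] at h2
  linarith

theorem volume_gauge_le_lt_top : volume {x | gauge x ≤ 1} < ⊤ :=
  (measure_mono fun _ hx => mem_closedBall_zero_iff.2 (norm_le_of_gauge_le hx)).trans_lt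
    (isCompact_closedBall (0 : Plane) 2).measure_lt_top

theorem volume_gauge_le {s : ℝ} (hs : 0 < s) :
    volume {x | gauge x ≤ s} = ENNReal.ofReal (s ^ (5 / 4 : ℝ)) * volume {x | gauge x ≤ 1} := by
  have h := withDensity_gauge_le (ρ := 1) 0 (by simp) hs
  rw [withDensity_one] at h
  simpa using h

theorem integrable_one_add_gauge : Integrable fun x => (1 + gauge x) ^ (-(9 / 4) : ℝ) := by
  have h := lintegral_one_add_rpow gauge_nonneg continuous_gauge.measurable
    (by norm_num : (0 : ℝ) < 5 / 4) (fun s hs => volume_gauge_le hs)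
  have hm : Measurable fun x => (1 + gauge x) ^ (-(9 / 4) : ℝ) :=
    (measurable_const.add continuous_gauge.measurable).pow_const _
  refine ⟨hm.aestronglyMeasurable, ?_⟩
  rw [hasFiniteIntegral_iff_ofReal (Eventually.of_forall fun x =>
    Real.rpow_nonneg (by linarith [gauge_nonneg x]) _)]
  rw [show (-(9 / 4) : ℝ) = -(5 / 4 + 1) by norm_num, h]
  exact volume_gauge_le_lt_top

theorem integrableOn_hor : IntegrableOn hor {x | gauge x ≤ 1} :=
  (continuous_hor.continuousOn.integrableOn_compact (isCompact_closedBall (0 : Plane) 2)).mono_set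
    fun _ hx => mem_closedBall_zero_iff.2 (norm_le_of_gauge_le hx)

theorem CHR_eq : CHR = 21 * ∫ x in {x | gauge x ≤ 1}, hor x := rfl

theorem CHR_pos : 0 < CHR := by
  rw [CHR_eq]
  refine mul_pos (by norm_num) ((setIntegral_pos_iff_support_of_nonneg_ae
    (Eventually.of_forall hor_nonneg) integrableOn_hor).2 ?_)
  have ho : IsOpen {x | 0 < hor x ∧ gauge x < 1} :=
    (isOpen_lt continuous_const continuous_hor).inter (isOpen_lt continuous_gauge continuous_const)
  refine (ho.measure_pos volume ⟨!₂[1 / 2, 0, 0, 0], ?_⟩).trans_le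
    (measure_mono fun x hx => ⟨hx.1.ne', hx.2.le⟩)
  constructor
  · simp [hor]
  · simp [gauge, hor]; norm_num

/-- The measure with density `hor` has sublevel masses proportional to s^(7/4), and 11/4 = 7/4 + 1,
so the layer cake identity returns the mass of the unit gauge ball. This is what fixes the
normalization of Γ. -/
theorem integral_hor_one_add_gauge :
    ∫ x, hor x * (1 + gauge x) ^ (-(11 / 4) : ℝ) = CHR / 21 := by
  have hρm : Measurable fun x => ENNReal.ofReal (hor x) :=
    ENNReal.measurable_ofReal.comp continuous_hor.measurable
  have hm : Measurable fun x => (1 + gauge x) ^ (-(11 / 4) : ℝ) :=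
    (measurable_const.add continuous_gauge.measurable).pow_const _
  have h := lintegral_one_add_rpow (μ := volume.withDensity fun x => ENNReal.ofReal (hor x))
    gauge_nonneg continuous_gauge.measurable (by norm_num : (0 : ℝ) < 7 / 4)
    (W := ∫⁻ x in {x | gauge x ≤ 1}, ENNReal.ofReal (hor x)) (fun s hs => by
      have := withDensity_gauge_le (ρ := fun x => ENNReal.ofReal (hor x)) 2
        (fun t ht x => by rw [hor_dil, ENNReal.ofReal_mul (by positivity)]) hs
      rw [this]
      norm_num)
  rw [lintegral_withDensity_eq_lintegral_mul _ hρm (by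
    exact ENNReal.measurable_ofReal.comp
      ((measurable_const.add continuous_gauge.measurable).pow_const _))] at h
  rw [CHR_eq, mul_div_cancel_left₀ _ (by norm_num : (21 : ℝ) ≠ 0),
    integral_eq_lintegral_of_nonneg_ae (Eventually.of_forall hor_nonneg)
      continuous_hor.aestronglyMeasurable, ← h,
    integral_eq_lintegral_of_nonneg_ae (Eventually.of_forall fun x => mul_nonneg (hor_nonneg x)
      (Real.rpow_nonneg (by linarith [gauge_nonneg x]) _))
      (continuous_hor.measurable.mul hm).aestronglyMeasurable]
  congr 1
  refine lintegral_congr fun x => ?_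
  simp only [Pi.mul_apply]
  rw [ENNReal.ofReal_mul (hor_nonneg x)]
  norm_num

/-- The matrix of the blow-up at `z`, from the model to the frame `T₁, …, T₄` at `z`. -/
def frame (z : Plane) (t : ℝ) : Matrix (Fin 4) (Fin 4) ℝ := fun i j =>
  ![t * ‖z‖⁻¹, t * ‖z‖⁻¹, t ^ 2 * ‖z‖⁻¹ ^ 2, t * ‖z‖⁻¹] j * A z i (![0, 1, 3, 2] j)

/-- The fields T_j(z) are orthogonal of length |z|. The third model coordinate is the vertical one
and is sent to T_4(z), hence the permutation `![0, 1, 3, 2]`; its scale t²/|z|² makes ω equal to -t²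
x₃ exactly. The Gram matrix yields the determinant up to sign. -/
theorem frame_transpose_mul {z : Plane} (hz : z ≠ 0) (t : ℝ) :
    (frame z t).transpose * frame z t
      = Matrix.diagonal ![t ^ 2, t ^ 2, t ^ 4 * ‖z‖⁻¹ ^ 2, t ^ 2] := by
  have hk : ‖z‖⁻¹ ^ 2 * (z 0 ^ 2 + z 1 ^ 2 + z 2 ^ 2 + z 3 ^ 2) = 1 := by
    rw [← norm_sq_eq, ← mul_pow, inv_mul_cancel₀ (norm_ne_zero_iff.2 hz), one_pow]
  ext i j
  simp only [Matrix.mul_apply, Matrix.transpose_apply, Fin.sum_univ_four, frame]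
  generalize ‖z‖⁻¹ = k at *
  fin_cases i <;> fin_cases j <;> simp [A] <;> try ring1
  · linear_combination t ^ 2 * hk
  · linear_combination t ^ 2 * hk
  · linear_combination t ^ 4 * k ^ 2 * hk
  · linear_combination t ^ 2 * hk

theorem abs_det_frame {z : Plane} (hz : z ≠ 0) {t : ℝ} (ht : 0 < t) :
    |(frame z t).det| = t ^ 5 * ‖z‖⁻¹ := by
  have h := congrArg Matrix.det (frame_transpose_mul hz t)
  rw [Matrix.det_mul, Matrix.det_transpose, Matrix.det_diagonal, Fin.prod_univ_four] at h
  refine (pow_left_inj₀ (abs_nonneg _) (by positivity) two_ne_zero).1 ?_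
  rw [sq_abs, sq, h]
  simp
  ring

theorem det_frame_ne_zero {z : Plane} (hz : z ≠ 0) {t : ℝ} (ht : 0 < t) :
    (frame z t).det ≠ 0 := by
  have : 0 < ‖z‖ := norm_pos_iff.2 hz
  rw [← abs_pos, abs_det_frame hz ht]
  positivity

theorem norm_sq_frame {z : Plane} (hz : z ≠ 0) (t : ℝ) (x : Plane) :
    ‖lin (frame z t) x‖ ^ 2 = t ^ 2 * (hor x + t ^ 2 * ‖z‖⁻¹ ^ 2 * x 2 ^ 2) := by
  have hk : ‖z‖⁻¹ ^ 2 * (z 0 ^ 2 + z 1 ^ 2 + z 2 ^ 2 + z 3 ^ 2) = 1 := by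
    rw [← norm_sq_eq, ← mul_pow, inv_mul_cancel₀ (norm_ne_zero_iff.2 hz), one_pow]
  rw [norm_sq_eq]
  simp only [lin_apply, Fin.sum_univ_four, frame, hor]
  generalize ‖z‖⁻¹ = k at hk
  simp [A]
  linear_combination
    (t ^ 2 * (x 0 ^ 2 + x 1 ^ 2 + x 3 ^ 2 + t ^ 2 * k ^ 2 * x 2 ^ 2)) * hk

theorem omega_frame {z : Plane} (hz : z ≠ 0) (t : ℝ) (x : Plane) :
    omega (z + lin (frame z t) x) z = -(t ^ 2 * x 2) := by
  have hk : ‖z‖⁻¹ ^ 2 * (z 0 ^ 2 + z 1 ^ 2 + z 2 ^ 2 + z 3 ^ 2) = 1 := by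
    rw [← norm_sq_eq, ← mul_pow, inv_mul_cancel₀ (norm_ne_zero_iff.2 hz), one_pow]
  simp only [omega, PiLp.add_apply, lin_apply, Fin.sum_univ_four, frame]
  generalize ‖z‖⁻¹ = k at hk
  simp [A]
  linear_combination (-(t ^ 2 * x 2)) * hk

/-- The fourth power of the rescaled distance in the coordinates of the blow-up. -/
def blow (z : Plane) (t : ℝ) (x : Plane) : ℝ :=
  (hor x + t ^ 2 * ‖z‖⁻¹ ^ 2 * x 2 ^ 2) ^ 2 + 4 * x 2 ^ 2

theorem N_frame {z : Plane} (hz : z ≠ 0) (t : ℝ) (x : Plane) :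
    N z (z + lin (frame z t) x) = t ^ 4 * blow z t x := by
  rw [N, omega_frame hz, add_sub_cancel_left, blow,
    show ‖lin (frame z t) x‖ ^ 4 = (‖lin (frame z t) x‖ ^ 2) ^ 2 by ring, norm_sq_frame hz]
  ring

theorem gauge_le_blow (z : Plane) (t : ℝ) (x : Plane) : gauge x ≤ blow z t x := by
  unfold gauge blow
  have := hor_nonneg x
  gcongr
  exact le_add_of_nonneg_right (by positivity)

/-- Near the pole, the frame coordinates with t = 1 give N ≥ gauge, and 1/gauge is integrable on the
unit gauge ball because its sublevel volumes grow like s^(5/4) with 5/4 > 1. -/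
theorem locallyIntegrable_inv_N {z : Plane} (hz : z ≠ 0) :
    LocallyIntegrable (fun y => (N z y)⁻¹) volume := by
  have hc : Continuous (N z) := (contDiff_N z (n := 0)).continuous
  have hopen : IsOpen {y | N z y < 1} := isOpen_lt hc continuous_const
  intro y
  by_cases hy : y = z
  · subst hy
    refine ⟨{w | N y w < 1}, hopen.mem_nhds (by simp [N, omega, mul_comm]), ?_⟩
    refine ⟨(show Measurable fun w => (N y w)⁻¹ from hc.measurable.inv).aestronglyMeasurable, ?_⟩
    · rw [hasFiniteIntegral_iff_ofReal (Eventually.of_forall fun x => inv_nonneg.2 (N_nonneg _ _)),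
        ← lintegral_indicator hopen.measurableSet,
        lintegral_comp_add_lin (det_frame_ne_zero hz one_pos) y]
      refine ENNReal.mul_lt_top ENNReal.ofReal_lt_top (lt_of_le_of_lt ?_
        (lintegral_inv_lt_top gauge_nonneg continuous_gauge.measurable
          (by norm_num : (1 : ℝ) < 5 / 4) volume_gauge_le_lt_top.ne
          (fun s hs => volume_gauge_le hs)))
      rw [← lintegral_indicator (measurableSet_le continuous_gauge.measurable measurable_const)]
      refine lintegral_mono_ae ?_
      have h0 : ∀ᵐ x : Plane, x ≠ 0 := by simp [ae_iff]
      filter_upwards [h0] with x hx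
      have hN := N_frame hz 1 x
      have hle := gauge_le_blow y 1 x
      rw [one_pow, one_mul] at hN
      by_cases h : N y (y + lin (frame y 1) x) < 1
      · have h1 : gauge x ≤ 1 := by linarith
        rw [Set.indicator_of_mem (show _ ∈ {w | N y w < 1} from h),
          Set.indicator_of_mem (show x ∈ {x | gauge x ≤ 1} from h1), hN]
        refine ENNReal.ofReal_le_ofReal (inv_anti₀ ?_ hle)
        exact gauge_pos hx
      · rw [Set.indicator_of_notMem (show _ ∉ {w | N y w < 1} from h)]
        exact zero_le
  · have hcont : ContinuousOn (fun y => (N z y)⁻¹) {z}ᶜ :=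
      hc.continuousOn.inv₀ fun w hw => (N_pos hw).ne'
    have h := hcont.locallyIntegrableOn (μ := volume) isOpen_compl_singleton.measurableSet y hy
    rwa [isOpen_compl_singleton.nhdsWithin_eq hy] at h

theorem tendsto_integral_blow {z : Plane} (hz : z ≠ 0) {h : Plane → ℝ} (hc : Continuous h)
    (hs : HasCompactSupport h) :
    Tendsto (fun t : ℝ => ∫ y, t ^ 4 * (N z y + t ^ 4) ^ (-(11 / 4) : ℝ) * (‖y - z‖ ^ 2 * h y))
      (𝓝[>] 0) (𝓝 (‖z‖⁻¹ * (CHR / 21 * h z))) := by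
  set hb : ℝ → Plane → ℝ := fun t x => hor x + t ^ 2 * ‖z‖⁻¹ ^ 2 * x 2 ^ 2 with hhb
  have hb0 : ∀ t x, 0 ≤ hb t x := fun t x => by
    have := hor_nonneg x
    simp only [hhb]; positivity
  have hbl : ∀ t x, 0 ≤ blow z t x := fun t x => (gauge_nonneg x).trans (gauge_le_blow z t x)
  -- The powers of t balance: 4 from ε, 5 from the Jacobian, 2 from |y-z|², and -11 from
  -- (t⁴)^(-11/4).
  have e : ∀ t > 0, ∫ y, t ^ 4 * (N z y + t ^ 4) ^ (-(11 / 4) : ℝ) * (‖y - z‖ ^ 2 * h y)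
      = ‖z‖⁻¹ * ∫ x, hb t x * (1 + blow z t x) ^ (-(11 / 4) : ℝ) * h (z + lin (frame z t) x) := by
    intro t ht
    rw [integral_comp_add_lin (det_frame_ne_zero hz ht) z, abs_det_frame hz ht,
      mul_comm (t ^ 5), mul_assoc, ← integral_const_mul]
    congr 2
    ext x
    have h1 : 0 ≤ 1 + blow z t x := by linarith [hbl t x]
    rw [N_frame hz, add_sub_cancel_left, norm_sq_frame hz,
      show t ^ 4 * blow z t x + t ^ 4 = t ^ 4 * (1 + blow z t x) by ring,
      Real.mul_rpow (by positivity) h1]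
    have h2 : (t ^ 4) ^ (-(11 / 4) : ℝ) = (t ^ 11)⁻¹ := by
      rw [← Real.rpow_natCast, ← Real.rpow_mul ht.le, ← Real.rpow_natCast, ← Real.rpow_neg ht.le]
      norm_num
    rw [h2]
    simp only [hhb]
    field_simp
  obtain ⟨B, hB⟩ := hc.bounded_above_of_compact_support hs
  have hlim : Tendsto
      (fun t => ∫ x, hb t x * (1 + blow z t x) ^ (-(11 / 4) : ℝ) * h (z + lin (frame z t) x))
      (𝓝[>] 0) (𝓝 (∫ x, hor x * (1 + gauge x) ^ (-(11 / 4) : ℝ) * h z)) := by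
    refine tendsto_integral_filter_of_dominated_convergence
      (fun x => (1 + gauge x) ^ (-(9 / 4) : ℝ) * B) ?_ ?_ (integrable_one_add_gauge.mul_const B) ?_
    · refine Eventually.of_forall fun t => Continuous.aestronglyMeasurable ?_
      have h1 : Continuous (hb t) := by
        have := continuous_hor
        fun_prop
      have h2 : Continuous (blow z t) := (h1.pow 2).add (by fun_prop)
      refine (h1.mul ((continuous_const.add h2).rpow_const fun x => Or.inl ?_)).mul
        (hc.comp (by fun_prop))
      exact (show 0 < 1 + blow z t x by linarith [hbl t x]).ne'
    · refine Eventually.of_forall fun t => Eventually.of_forall fun x => ?_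
      have h1 : 0 < 1 + blow z t x := by linarith [hbl t x]
      rw [norm_mul, Real.norm_of_nonneg (mul_nonneg (hb0 t x) (Real.rpow_nonneg h1.le _))]
      refine mul_le_mul ?_ (hB _) (norm_nonneg _)
        (Real.rpow_nonneg (by linarith [gauge_nonneg x]) _)
      -- The horizontal factor costs half a power, leaving the exponent -9/4 = -(5/4 + 1), which is
      -- integrable and, since blow ≥ gauge, bounded independently of t.
      have h2 : hb t x ≤ (1 + blow z t x) ^ (1 / 2 : ℝ) := by
        rw [← Real.sqrt_eq_rpow]
        refine Real.le_sqrt_of_sq_le ?_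
        simp only [blow, hhb]
        nlinarith [sq_nonneg (x 2)]
      calc hb t x * (1 + blow z t x) ^ (-(11 / 4) : ℝ)
          ≤ (1 + blow z t x) ^ (1 / 2 : ℝ) * (1 + blow z t x) ^ (-(11 / 4) : ℝ) := by gcongr
        _ = (1 + blow z t x) ^ (-(9 / 4) : ℝ) := by rw [← Real.rpow_add h1]; norm_num
        _ ≤ (1 + gauge x) ^ (-(9 / 4) : ℝ) := by
          refine Real.rpow_le_rpow_of_nonpos (by linarith [gauge_nonneg x]) ?_ (by norm_num)
          linarith [gauge_le_blow z t x]
    · refine Eventually.of_forall fun x => ?_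
      have h0 : ContinuousAt (fun t =>
          hb t x * (1 + blow z t x) ^ (-(11 / 4) : ℝ) * h (z + lin (frame z t) x)) 0 := by
        have h1 : Continuous fun t => hb t x := by simp only [hhb]; fun_prop
        have h2 : Continuous fun t => blow z t x := by unfold blow; fun_prop
        have h3 : Continuous fun t => z + lin (frame z t) x := by
          refine continuous_const.add ?_
          refine (contDiff_zero (𝕜 := ℝ)).1 (contDiff_euclidean.2 fun i => ?_)
          simp only [lin_apply, frame, Fin.sum_univ_four]
          simp
          fun_prop
        refine ((h1.mul ((continuous_const.add h2).rpow_const fun t => Or.inl ?_)).mul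
          (hc.comp h3)).continuousAt
        exact (show 0 < 1 + blow z t x by linarith [hbl t x]).ne'
      have h4 : z + lin (frame z 0) x = z := by
        rw [add_eq_left]
        ext i
        rw [lin_apply]
        fin_cases i <;> simp [frame, Fin.sum_univ_four]
      have h5 := h0.tendsto.mono_left (nhdsWithin_le_nhds (s := Set.Ioi 0))
      rw [h4] at h5
      simpa [hhb, blow, gauge] using h5
  rw [integral_mul_const, integral_hor_one_add_gauge] at hlim
  refine (hlim.const_mul ‖z‖⁻¹).congr' ?_
  filter_upwards [self_mem_nhdsWithin] with t ht
  exact (e t ht).symm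

end Model

/-! ### Domination and passage to the limit ε → 0 -/

section Limit

/-- The locally integrable majorant of all the integrands. -/
def maj (z y : Plane) : ℝ := (1 + ‖y‖⁻¹ ^ 2) * (1 + (N z y)⁻¹)

theorem continuous_N (z : Plane) : Continuous (N z) := (contDiff_N z (n := 0)).continuous

theorem ae_ne (z : Plane) : ∀ᵐ y : Plane, y ≠ z := by simp [ae_iff]

theorem measurable_maj (z : Plane) : Measurable (maj z) := by
  have := (continuous_N z).measurable
  unfold maj
  fun_prop

theorem inv_N_nonneg (z y : Plane) : 0 ≤ (N z y)⁻¹ := inv_nonneg.2 (N_nonneg z y)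

theorem maj_nonneg (z y : Plane) : 0 ≤ maj z y := by
  have := inv_N_nonneg z y
  unfold maj; positivity

/-- The singularities at 0 and at z are separated: where |y| ≥ |z|/2 the first factor is bounded,
and elsewhere |y-z| ≥ |z|/2 bounds the second. -/
theorem locallyIntegrable_maj {z : Plane} (hz : z ≠ 0) : LocallyIntegrable (maj z) volume := by
  have hz' : 0 < ‖z‖ := norm_pos_iff.2 hz
  have h1 : LocallyIntegrable (fun y => (1 + (‖z‖ / 2)⁻¹ ^ 2) • (1 + (N z y)⁻¹)
      + (1 + ((‖z‖ / 2) ^ 4)⁻¹) • (1 + ‖y‖⁻¹ ^ 2)) volume :=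
    (((locallyIntegrable_const 1).add (locallyIntegrable_inv_N hz)).smul (1 + (‖z‖ / 2)⁻¹ ^ 2)).add
      (((locallyIntegrable_const 1).add (locallyIntegrable_norm_inv_pow (k := 2) (by norm_num))).smul
        (1 + ((‖z‖ / 2) ^ 4)⁻¹))
  refine h1.mono (measurable_maj z).aestronglyMeasurable (Eventually.of_forall fun y => ?_)
  have hN := inv_N_nonneg z y
  rw [Real.norm_of_nonneg (maj_nonneg z y), Real.norm_of_nonneg (by
    simp only [smul_eq_mul]; positivity)]
  simp only [smul_eq_mul, maj]
  by_cases h : ‖z‖ / 2 ≤ ‖y‖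
  · have : ‖y‖⁻¹ ≤ (‖z‖ / 2)⁻¹ := inv_anti₀ (by positivity) h
    calc (1 + ‖y‖⁻¹ ^ 2) * (1 + (N z y)⁻¹) ≤ (1 + (‖z‖ / 2)⁻¹ ^ 2) * (1 + (N z y)⁻¹) := by gcongr
      _ ≤ _ := le_add_of_nonneg_right (by positivity)
  · have h2 : ‖z‖ / 2 ≤ ‖y - z‖ := by
      have := norm_sub_norm_le z y
      rw [norm_sub_rev] at this
      linarith
    have : (N z y)⁻¹ ≤ ((‖z‖ / 2) ^ 4)⁻¹ := by
      refine inv_anti₀ (by positivity) ?_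
      calc (‖z‖ / 2) ^ 4 ≤ ‖y - z‖ ^ 4 := by gcongr
        _ ≤ N z y := le_add_of_nonneg_right (by positivity)
    calc (1 + ‖y‖⁻¹ ^ 2) * (1 + (N z y)⁻¹) ≤ (1 + ‖y‖⁻¹ ^ 2) * (1 + ((‖z‖ / 2) ^ 4)⁻¹) := by gcongr
      _ = (1 + ((‖z‖ / 2) ^ 4)⁻¹) * (1 + ‖y‖⁻¹ ^ 2) := mul_comm _ _
      _ ≤ _ := le_add_of_nonneg_left (by positivity)

theorem integrable_maj_mul {z : Plane} (hz : z ≠ 0) {g : Plane → ℝ} (hg : Continuous g)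
    (hc : HasCompactSupport g) : Integrable (fun y => maj z y * g y) volume := by
  simpa [mul_comm] using
    (locallyIntegrable_maj hz).integrable_smul_left_of_hasCompactSupport hg hc

theorem norm_inv_le (y : Plane) : ‖y‖⁻¹ ≤ 1 + ‖y‖⁻¹ ^ 2 := by
  nlinarith [sq_nonneg (‖y‖⁻¹ - 1), sq_nonneg ‖y‖⁻¹]

theorem rpow_le_one_add_inv {s : ℝ} (hs : 0 < s) : s ^ (-(3 / 4) : ℝ) ≤ 1 + s⁻¹ := by
  rcases le_total 1 s with h | h
  · have := Real.rpow_le_one_of_one_le_of_nonpos h (by norm_num : (-(3 / 4) : ℝ) ≤ 0)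
    have h2 := inv_nonneg.2 hs.le
    linarith
  · have := Real.rpow_le_rpow_of_exponent_ge hs h (by norm_num : (-1 : ℝ) ≤ -(3 / 4))
    rw [Real.rpow_neg_one] at this
    linarith

theorem rpow_add_le {s ε p : ℝ} (hs : 0 < s) (hε : 0 ≤ ε) (hp : 0 ≤ p) :
    (s + ε) ^ (-p) ≤ s ^ (-p) :=
  Real.rpow_le_rpow_of_nonpos hs (by linarith) (by linarith)

theorem abs_Gr_le {ε : ℝ} (hε : 0 ≤ ε) {z y : Plane} (h : y ≠ z) :
    |Gr ε z y| ≤ CHR⁻¹ * (1 + (N z y)⁻¹) := by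
  have hC := CHR_pos
  have hN := N_pos h
  rw [Gr, abs_of_nonneg (by positivity)]
  gcongr
  exact (rpow_add_le hN hε (by norm_num)).trans (rpow_le_one_add_inv hN)

theorem tendsto_rpow_add {s : ℝ} (hs : 0 < s) (p : ℝ) :
    Tendsto (fun ε => (s + ε) ^ p) (𝓝[>] 0) (𝓝 (s ^ p)) := by
  have h : ContinuousAt (fun ε => (s + ε) ^ p) 0 :=
    (continuousAt_const.add continuousAt_id).rpow_const (Or.inl (by simpa using hs.ne'))
  simpa using h.tendsto.mono_left (nhdsWithin_le_nhds (s := Set.Ioi 0))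

theorem contDiff_Gr {ε : ℝ} (hε : 0 < ε) (z : Plane) {n : WithTop ℕ∞} : ContDiff ℝ n (Gr ε z) :=
  contDiff_iff_contDiffAt.2 fun y => contDiffAt_Gr (by linarith [N_nonneg z y])

variable {φ : Plane → ℝ}

theorem abs_wdv_grad_le (z y : Plane) :
    |wdv (grad z φ) y| ≤ (1 + ‖y‖⁻¹ ^ 2) * (|dv (grad z φ) y| + ‖grad z φ y‖) := by
  refine (abs_sub _ _).trans ?_
  have h1 := abs_inner_div_le y (grad z φ y)
  rw [Real.norm_eq_abs] at h1
  have h2 : |‖y‖⁻¹ * dv (grad z φ) y| ≤ (1 + ‖y‖⁻¹ ^ 2) * |dv (grad z φ) y| := by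
    rw [abs_mul, abs_of_nonneg (by positivity : 0 ≤ ‖y‖⁻¹)]
    gcongr
    exact norm_inv_le y
  have h3 := norm_nonneg (grad z φ y)
  linarith

theorem tendsto_integral_Gr_mul_Lap {z : Plane} (hz : z ≠ 0) (hφ : ContDiff ℝ 2 φ)
    (hc : HasCompactSupport φ) :
    Integrable (fun y => Gr 0 z y * (‖y‖ * Lap z φ y)) volume ∧
    Tendsto (fun ε => ∫ y, Gr ε z y * (‖y‖ * Lap z φ y)) (𝓝[>] 0)
      (𝓝 (∫ y, Gr 0 z y * (‖y‖ * Lap z φ y))) := by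
  have hg : Integrable (fun y => maj z y * (CHR⁻¹ * (|dv (grad z φ) y| + ‖grad z φ y‖))) volume :=
    integrable_maj_mul hz (continuous_const.mul ((continuous_dv (contDiff_grad z hφ)).abs.add
      (contDiff_grad z hφ).continuous.norm))
      ((((hasCompactSupport_dv (hasCompactSupport_grad z hc)).norm).add
        (hasCompactSupport_grad z hc).norm).mul_left)
  have hm : AEStronglyMeasurable (fun y => ‖y‖ * Lap z φ y) volume := by
    refine (integrable_wdv (contDiff_grad z hφ) (hasCompactSupport_grad z hc)).neg.1.congr ?_
    filter_upwards [ae_ne 0] with y hy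
    exact (norm_mul_Lap z hy hφ.contDiffAt).symm
  have hGm : ∀ ε, AEStronglyMeasurable (Gr ε z) volume := fun ε => by
    have := (continuous_N z).measurable
    exact Measurable.aestronglyMeasurable (by unfold Gr; fun_prop)
  have hb : ∀ ε ≥ 0, ∀ᵐ y, ‖Gr ε z y * (‖y‖ * Lap z φ y)‖
      ≤ maj z y * (CHR⁻¹ * (|dv (grad z φ) y| + ‖grad z φ y‖)) := by
    intro ε hε
    filter_upwards [ae_ne 0, ae_ne z] with y hy hyz
    have hC := CHR_pos
    have hN := N_pos hyz
    rw [norm_mul_Lap z hy hφ.contDiffAt, norm_mul, norm_neg, Real.norm_eq_abs, Real.norm_eq_abs]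
    calc |Gr ε z y| * |wdv (grad z φ) y|
        ≤ (CHR⁻¹ * (1 + (N z y)⁻¹))
          * ((1 + ‖y‖⁻¹ ^ 2) * (|dv (grad z φ) y| + ‖grad z φ y‖)) := by
          gcongr
          · exact abs_Gr_le hε hyz
          · exact abs_wdv_grad_le z y
      _ = _ := by rw [maj]; ring
  refine ⟨hg.mono' ((hGm 0).mul hm) (hb 0 le_rfl), ?_⟩
  refine tendsto_integral_filter_of_dominated_convergence _
    (Eventually.of_forall fun ε => (hGm ε).mul hm) ?_ hg ?_
  · filter_upwards [self_mem_nhdsWithin] with ε hε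
    exact hb ε (le_of_lt hε)
  · filter_upwards [ae_ne z] with y hyz
    simp only [Gr, add_zero]
    exact ((tendsto_rpow_add (N_pos hyz) _).const_mul _).mul_const _

/-- The derivative of the regularization along `V_j`. -/
def dGr (ε : ℝ) (z : Plane) (j : Fin 4) (y : Plane) : ℝ :=
  -(3 / 4) * CHR⁻¹ * (N z y + ε) ^ (-(7 / 4) : ℝ) * fderiv ℝ (N z) y (V z j y)

theorem fderiv_Gr {ε : ℝ} {z y : Plane} (h : 0 < N z y + ε) (j : Fin 4) :
    fderiv ℝ (Gr ε z) y (V z j y) = dGr ε z j y := by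
  rw [(hasFDerivAt_Gr h).fderiv]; rfl

theorem tendsto_integral_dGr_mul {z : Plane} (hz : z ≠ 0) (hφ : ContDiff ℝ 2 φ)
    (hc : HasCompactSupport φ) (j : Fin 4) :
    (∀ ε ≥ 0, Integrable (fun y => ‖y‖⁻¹ * (dGr ε z j y * fderiv ℝ φ y (V z j y))) volume) ∧
    Tendsto (fun ε => ∫ y, ‖y‖⁻¹ * (dGr ε z j y * fderiv ℝ φ y (V z j y))) (𝓝[>] 0)
      (𝓝 (∫ y, ‖y‖⁻¹ * (dGr 0 z j y * fderiv ℝ φ y (V z j y)))) := by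
  have hV := (contDiff_V z j (n := 0)).continuous
  have hφc : Continuous fun y => fderiv ℝ φ y (V z j y) :=
    (hφ.continuous_fderiv (by norm_num)).clm_apply hV
  have hNc : Continuous fun y => fderiv ℝ (N z) y (V z j y) :=
    ((contDiff_N z (n := 1)).continuous_fderiv one_ne_zero).clm_apply hV
  have hsupp : HasCompactSupport fun y => fderiv ℝ φ y (V z j y) :=
    (hc.fderiv (𝕜 := ℝ)).mono fun y hy h => hy (by simp [h])
  have hg : Integrable (fun y => maj z y * (3 * CHR⁻¹ * (‖y‖ + ‖y - z‖ + ‖z‖)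
      * |fderiv ℝ φ y (V z j y)|)) volume :=
    integrable_maj_mul hz (by fun_prop) hsupp.norm.mul_left
  have hm : ∀ ε, AEStronglyMeasurable
      (fun y => ‖y‖⁻¹ * (dGr ε z j y * fderiv ℝ φ y (V z j y))) volume := fun ε => by
    have h1 := (continuous_N z).measurable
    have h2 := hNc.measurable
    have h3 := hφc.measurable
    exact Measurable.aestronglyMeasurable (by unfold dGr; fun_prop)
  have hb : ∀ ε ≥ 0, ∀ᵐ y, ‖‖y‖⁻¹ * (dGr ε z j y * fderiv ℝ φ y (V z j y))‖
      ≤ maj z y * (3 * CHR⁻¹ * (‖y‖ + ‖y - z‖ + ‖z‖) * |fderiv ℝ φ y (V z j y)|) := by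
    intro ε hε
    filter_upwards [ae_ne z] with y hyz
    have hC := CHR_pos
    have hN := N_pos hyz
    have hd : N z y ^ (-(7 / 4) : ℝ) * d y z ^ 3 = (N z y)⁻¹ := by
      rw [show d y z ^ 3 = d y z ^ (3 : ℤ) from rfl, d_zpow, ← Real.rpow_add hN,
        ← Real.rpow_neg_one]
      norm_num
    have hdG : |dGr ε z j y| ≤ 3 * CHR⁻¹ * (N z y)⁻¹ * (‖y‖ + ‖y - z‖ + ‖z‖) := by
      rw [dGr, abs_mul, abs_mul, abs_mul, abs_of_pos (inv_pos.2 hC),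
        abs_of_nonneg (by positivity : 0 ≤ (N z y + ε) ^ (-(7 / 4) : ℝ))]
      calc |(-(3 / 4) : ℝ)| * CHR⁻¹ * (N z y + ε) ^ (-(7 / 4) : ℝ) * |fderiv ℝ (N z) y (V z j y)|
          ≤ |(-(3 / 4) : ℝ)| * CHR⁻¹ * N z y ^ (-(7 / 4) : ℝ)
            * (4 * d y z ^ 3 * (‖y‖ + ‖y - z‖ + ‖z‖)) := by
            refine mul_le_mul (mul_le_mul_of_nonneg_left (rpow_add_le hN hε (by norm_num))
              (by positivity)) (abs_along_N_le z y j) (abs_nonneg _) (by positivity)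
        _ = 3 * CHR⁻¹ * (N z y ^ (-(7 / 4) : ℝ) * d y z ^ 3) * (‖y‖ + ‖y - z‖ + ‖z‖) := by
            norm_num; ring
        _ = _ := by rw [hd]
    rw [norm_mul, norm_mul, norm_inv, norm_norm, Real.norm_eq_abs, Real.norm_eq_abs]
    calc ‖y‖⁻¹ * (|dGr ε z j y| * |fderiv ℝ φ y (V z j y)|)
        ≤ (1 + ‖y‖⁻¹ ^ 2) * ((3 * CHR⁻¹ * (1 + (N z y)⁻¹) * (‖y‖ + ‖y - z‖ + ‖z‖))
          * |fderiv ℝ φ y (V z j y)|) := by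
          gcongr
          · exact norm_inv_le y
          · refine hdG.trans ?_
            gcongr
            linarith
      _ = _ := by rw [maj]; ring
  refine ⟨fun ε hε => hg.mono' (hm ε) (hb ε hε), ?_⟩
  refine tendsto_integral_filter_of_dominated_convergence _ (Eventually.of_forall hm) ?_ hg ?_
  · filter_upwards [self_mem_nhdsWithin] with ε hε
    exact hb ε (le_of_lt hε)
  · filter_upwards [ae_ne z] with y hyz
    simp only [dGr, add_zero]
    exact ((((tendsto_rpow_add (N_pos hyz) _).const_mul _).mul_const _).mul_const _).const_mul _

theorem aestronglyMeasurable_f (z : Plane) : AEStronglyMeasurable (f z) volume := by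
  have h1 := (continuous_N z).measurable
  have hd : Measurable fun y => d y z := by
    simp only [d_eq_N]; fun_prop
  have ho : Measurable fun y => omega z y := by
    unfold omega; fun_prop
  have hb : Measurable fun y : Plane => (inner ℝ z (y - z) : ℝ) :=
    (continuous_const.inner (continuous_id.sub continuous_const)).measurable
  have hm : Measurable fun y => 3 * (d y z ^ 11)⁻¹ / (4 * CHR * ‖y‖ ^ 2) *
        (-(7 / 4) * R13 y z + d y z ^ 4 * R23 y z + d y z ^ 4 * R33 y z
          - 112 * omega z y ^ 4) := by
    unfold R13 R23 R33
    fun_prop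
  refine hm.aestronglyMeasurable.congr ?_
  filter_upwards [ae_ne 0, ae_ne z] with y hy hyz
  rw [f_eq hy hyz]
  rfl

theorem abs_f_le_maj {z y : Plane} (hy : y ≠ 0) (hyz : y ≠ z) :
    |f z y| ≤ 105 * CHR⁻¹ * ‖z‖ * ‖y‖⁻¹ ^ 2 * (N z y)⁻¹ := by
  have h := abs_f_le hy hyz
  rwa [d_zpow, abs_of_pos (inv_pos.2 CHR_pos), show ((-4 : ℤ) : ℝ) / 4 = -1 by norm_num,
    Real.rpow_neg_one] at h

theorem integrable_norm_mul_f {z : Plane} (hz : z ≠ 0) (hφ : Continuous φ)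
    (hc : HasCompactSupport φ) : Integrable (fun y => φ y * (‖y‖ * f z y)) volume := by
  have hg : Integrable (fun y => maj z y * (105 * CHR⁻¹ * ‖z‖ * |φ y|)) volume :=
    integrable_maj_mul hz (by fun_prop) hc.norm.mul_left
  refine hg.mono' (hφ.aestronglyMeasurable.mul
    (continuous_norm.aestronglyMeasurable.mul (aestronglyMeasurable_f z))) ?_
  filter_upwards [ae_ne 0, ae_ne z] with y hy hyz
  have hC := CHR_pos
  have hN := N_pos hyz
  have hy' : 0 < ‖y‖ := norm_pos_iff.2 hy
  rw [norm_mul, norm_mul, norm_norm, Real.norm_eq_abs, Real.norm_eq_abs]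
  calc |φ y| * (‖y‖ * |f z y|)
      ≤ |φ y| * (‖y‖ * (105 * CHR⁻¹ * ‖z‖ * ‖y‖⁻¹ ^ 2 * (N z y)⁻¹)) := by
        gcongr
        exact abs_f_le_maj hy hyz
    _ = ‖y‖⁻¹ * (N z y)⁻¹ * (105 * CHR⁻¹ * ‖z‖ * |φ y|) := by field_simp
    _ ≤ (1 + ‖y‖⁻¹ ^ 2) * (1 + (N z y)⁻¹) * (105 * CHR⁻¹ * ‖z‖ * |φ y|) := by
        gcongr
        · exact norm_inv_le y
        · linarith

/-- Pointwise the integrand tends to 0 off the pole. It is dominated since ε (N+ε)^(-11/4) ≤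
N^(-7/4) and the error is O(|y|⁻¹ d³), in all O(|y|⁻¹ N⁻¹). The same argument for the main term
would give only d⁻⁵, which is critical in homogeneous dimension 5, and there a point mass survives.
-/
theorem tendsto_integral_err {z : Plane} (hz : z ≠ 0) (hφ : Continuous φ)
    (hc : HasCompactSupport φ) :
    (∀ ε > 0, Integrable (fun y => ε * (N z y + ε) ^ (-(11 / 4) : ℝ) * (err z y * φ y)) volume) ∧
    Tendsto (fun ε => ∫ y, ε * (N z y + ε) ^ (-(11 / 4) : ℝ) * (err z y * φ y)) (𝓝[>] 0)
      (𝓝 (∫ _ : Plane, (0 : ℝ))) := by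
  have hg : Integrable (fun y => maj z y * ((‖y - z‖ + 4 * ‖z‖) * |φ y|)) volume :=
    integrable_maj_mul hz (by fun_prop) hc.norm.mul_left
  have hm : ∀ ε, AEStronglyMeasurable
      (fun y => ε * (N z y + ε) ^ (-(11 / 4) : ℝ) * (err z y * φ y)) volume := fun ε => by
    have h1 := (continuous_N z).measurable
    have h2 : Measurable fun y => omega y z := by unfold omega; fun_prop
    have hb : Measurable fun y : Plane => (inner ℝ z (y - z) : ℝ) :=
      (continuous_const.inner (continuous_id.sub continuous_const)).measurable
    have h3 := hφ.measurable
    exact Measurable.aestronglyMeasurable (by unfold err; fun_prop)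
  have hb : ∀ ε > 0, ∀ᵐ y, ‖ε * (N z y + ε) ^ (-(11 / 4) : ℝ) * (err z y * φ y)‖
      ≤ maj z y * ((‖y - z‖ + 4 * ‖z‖) * |φ y|) := by
    intro ε hε
    filter_upwards [ae_ne z] with y hyz
    have hN := N_pos hyz
    have h1 : ε * (N z y + ε) ^ (-(11 / 4) : ℝ) ≤ N z y ^ (-(7 / 4) : ℝ) := by
      calc ε * (N z y + ε) ^ (-(11 / 4) : ℝ)
          ≤ (N z y + ε) * (N z y + ε) ^ (-(11 / 4) : ℝ) := by
            gcongr
            linarith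
        _ = (N z y + ε) ^ (-(7 / 4) : ℝ) := by
            rw [mul_comm, ← Real.rpow_add_one (by positivity)]; norm_num
        _ ≤ _ := rpow_add_le hN hε.le (by norm_num)
    have hd : N z y ^ (-(7 / 4) : ℝ) * d y z ^ 3 = (N z y)⁻¹ := by
      rw [show d y z ^ 3 = d y z ^ (3 : ℤ) from rfl, d_zpow, ← Real.rpow_add hN,
        ← Real.rpow_neg_one]
      norm_num
    rw [norm_mul, norm_mul (err z y), Real.norm_of_nonneg (by positivity), Real.norm_eq_abs,
      Real.norm_eq_abs]
    calc ε * (N z y + ε) ^ (-(11 / 4) : ℝ) * (|err z y| * |φ y|)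
        ≤ N z y ^ (-(7 / 4) : ℝ) * ((‖y‖⁻¹ * d y z ^ 3 * (‖y - z‖ + 4 * ‖z‖)) * |φ y|) := by
          gcongr
          refine (abs_err_le hyz).trans ?_
          gcongr
          exact norm_sub_le_d y z
      _ = ‖y‖⁻¹ * (N z y ^ (-(7 / 4) : ℝ) * d y z ^ 3) * ((‖y - z‖ + 4 * ‖z‖) * |φ y|) := by ring
      _ ≤ (1 + ‖y‖⁻¹ ^ 2) * (1 + (N z y)⁻¹) * ((‖y - z‖ + 4 * ‖z‖) * |φ y|) := by
          rw [hd]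
          gcongr
          · exact norm_inv_le y
          · linarith
  refine ⟨fun ε hε => hg.mono' (hm ε) (hb ε hε), ?_⟩
  refine tendsto_integral_filter_of_dominated_convergence _ (Eventually.of_forall hm) ?_ hg ?_
  · filter_upwards [self_mem_nhdsWithin] with ε hε
    exact hb ε hε
  · filter_upwards [ae_ne z] with y hyz
    have h0 : Tendsto (fun ε : ℝ => ε) (𝓝[>] 0) (𝓝 0) := nhdsWithin_le_nhds
    simpa using (h0.mul (tendsto_rpow_add (N_pos hyz) (-(11 / 4)))).mul_const (err z y * φ y)

theorem tendsto_integral_ratio {z : Plane} (hz : z ≠ 0) (hφ : Continuous φ)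
    (hc : HasCompactSupport φ) :
    (∀ ε > 0, Integrable
      (fun y => (N z y / (N z y + ε)) ^ (7 / 4 : ℝ) * (φ y * (‖y‖ * f z y))) volume) ∧
    Tendsto (fun ε => ∫ y, (N z y / (N z y + ε)) ^ (7 / 4 : ℝ) * (φ y * (‖y‖ * f z y))) (𝓝[>] 0)
      (𝓝 (∫ y, φ y * (‖y‖ * f z y))) := by
  have hi := integrable_norm_mul_f hz hφ hc
  have hm : ∀ ε, AEStronglyMeasurable
      (fun y => (N z y / (N z y + ε)) ^ (7 / 4 : ℝ) * (φ y * (‖y‖ * f z y))) volume := fun ε => by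
    have h1 := (continuous_N z).measurable
    have h2 : Measurable fun y => (N z y / (N z y + ε)) ^ (7 / 4 : ℝ) := by fun_prop
    exact h2.aestronglyMeasurable.mul hi.1
  have hb : ∀ ε > 0, ∀ᵐ y, ‖(N z y / (N z y + ε)) ^ (7 / 4 : ℝ) * (φ y * (‖y‖ * f z y))‖
      ≤ ‖φ y * (‖y‖ * f z y)‖ := by
    intro ε hε
    refine Eventually.of_forall fun y => ?_
    have hN := N_nonneg z y
    have h1 : (N z y / (N z y + ε)) ^ (7 / 4 : ℝ) ≤ 1 :=
      Real.rpow_le_one (by positivity) (div_le_one_of_le₀ (by linarith) (by positivity))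
        (by norm_num)
    rw [norm_mul, Real.norm_of_nonneg (by positivity)]
    exact mul_le_of_le_one_left (norm_nonneg _) h1
  refine ⟨fun ε hε => hi.norm.mono' (hm ε) (hb ε hε), ?_⟩
  refine tendsto_integral_filter_of_dominated_convergence _ (Eventually.of_forall hm) ?_ hi.norm ?_
  · filter_upwards [self_mem_nhdsWithin] with ε hε
    exact hb ε hε
  · filter_upwards [ae_ne z] with y hyz
    have hN := N_pos hyz
    have h : ContinuousAt (fun ε => (N z y / (N z y + ε)) ^ (7 / 4 : ℝ)) 0 :=
      (continuousAt_const.div (continuousAt_const.add continuousAt_id)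
        (by simpa using hN.ne')).rpow_const (Or.inr (by norm_num))
    have h2 := h.tendsto.mono_left (nhdsWithin_le_nhds (s := Set.Ioi 0))
    simp only [add_zero, div_self hN.ne', Real.one_rpow] at h2
    simpa using h2.mul_const (φ y * (‖y‖ * f z y))

theorem tendsto_pow_four : Tendsto (fun t : ℝ => t ^ 4) (𝓝[>] 0) (𝓝[>] 0) := by
  refine tendsto_nhdsWithin_iff.2 ⟨?_, ?_⟩
  · have : ContinuousAt (fun t : ℝ => t ^ 4) 0 := by fun_prop
    simpa using this.tendsto.mono_left (nhdsWithin_le_nhds (s := Set.Ioi 0))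
  · filter_upwards [self_mem_nhdsWithin] with t ht
    exact pow_pos (Set.mem_Ioi.1 ht) 4

theorem tendsto_integral_mul_Lap_Gr {z : Plane} (hz : z ≠ 0) (hφ : Continuous φ)
    (hc : HasCompactSupport φ) :
    Tendsto (fun t : ℝ => ∫ y, φ y * (‖y‖ * Lap z (Gr (t ^ 4) z) y)) (𝓝[>] 0)
      (𝓝 (φ z + ∫ y, φ y * (‖y‖ * f z y))) := by
  obtain ⟨i1, l1⟩ := tendsto_integral_ratio hz hφ hc
  obtain ⟨i3, l3⟩ := tendsto_integral_err hz hφ hc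
  rw [integral_zero] at l3
  have hh : Continuous fun y : Plane => ‖y‖ * φ y := by fun_prop
  have hhc : HasCompactSupport fun y : Plane => ‖y‖ * φ y := hc.mul_left
  have l2 := tendsto_integral_blow hz hh hhc
  have i2 : ∀ ε > 0, Integrable
      (fun y => ε * (N z y + ε) ^ (-(11 / 4) : ℝ) * (‖y - z‖ ^ 2 * (‖y‖ * φ y))) volume := by
    intro ε hε
    have hN := continuous_N z
    have h1 : Continuous fun y => (N z y + ε) ^ (-(11 / 4) : ℝ) :=
      (hN.add continuous_const).rpow_const fun y =>
        Or.inl (show 0 < N z y + ε by linarith [N_nonneg z y]).ne'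
    exact Continuous.integrable_of_hasCompactSupport (by fun_prop) hhc.mul_left.mul_left
  have hC := CHR_pos
  have key : ∀ ε > 0, ∫ y, φ y * (‖y‖ * Lap z (Gr ε z) y)
      = (∫ y, (N z y / (N z y + ε)) ^ (7 / 4 : ℝ) * (φ y * (‖y‖ * f z y)))
        + 21 * CHR⁻¹ * ((∫ y, ε * (N z y + ε) ^ (-(11 / 4) : ℝ) * (‖y - z‖ ^ 2 * (‖y‖ * φ y)))
          - ∫ y, ε * (N z y + ε) ^ (-(11 / 4) : ℝ) * (err z y * φ y)) := by
    intro ε hε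
    have i4 : Integrable (fun y => 21 * CHR⁻¹ *
        (ε * (N z y + ε) ^ (-(11 / 4) : ℝ) * (‖y - z‖ ^ 2 * (‖y‖ * φ y))
          - ε * (N z y + ε) ^ (-(11 / 4) : ℝ) * (err z y * φ y))) volume :=
      ((i2 ε hε).sub (i3 ε hε)).const_mul _
    rw [← integral_sub (i2 ε hε) (i3 ε hε), ← integral_const_mul, ← integral_add (i1 ε hε) i4]
    refine integral_congr_ae ?_
    filter_upwards [ae_ne 0, ae_ne z] with y hy hyz
    rw [norm_mul_Lap_Gr_eq hε hy hyz]
    ring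
  have hlim := (l1.comp tendsto_pow_four).add
    ((l2.sub (l3.comp tendsto_pow_four)).const_mul (21 * CHR⁻¹))
  -- The Jacobian factor |z|⁻¹ cancels the weight |y| at y = z, and C/21 cancels 21 C⁻¹, leaving
  -- unit mass.
  have hval : (∫ y, φ y * (‖y‖ * f z y)) + 21 * CHR⁻¹ * (‖z‖⁻¹ * (CHR / 21 * (‖z‖ * φ z)) - 0)
      = φ z + ∫ y, φ y * (‖y‖ * f z y) := by
    have : ‖z‖ ≠ 0 := norm_ne_zero_iff.2 hz
    field_simp
    ring
  rw [hval] at hlim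
  refine hlim.congr' ?_
  filter_upwards [self_mem_nhdsWithin] with t ht
  exact (key (t ^ 4) (pow_pos (Set.mem_Ioi.1 ht) 4)).symm

theorem integral_Gam_mul_Lap {z : Plane} (hz : z ≠ 0) (hφ : ContDiff ℝ 2 φ)
    (hc : HasCompactSupport φ) :
    ∫ y, Gr 0 z y * (‖y‖ * Lap z φ y) = φ z + ∫ y, φ y * (‖y‖ * f z y) := by
  refine tendsto_nhds_unique
    ((tendsto_integral_Gr_mul_Lap hz hφ hc).2.comp tendsto_pow_four)
    ((tendsto_integral_mul_Lap_Gr hz hφ.continuous hc).congr' ?_)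
  filter_upwards [self_mem_nhdsWithin] with t ht
  have hG := contDiff_Gr (pow_pos (Set.mem_Ioi.1 ht) 4) z (n := 2)
  -- Green's formula is applied in both directions: the symmetric bilinear form moves the operator
  -- from Γ_ε to φ.
  rw [Function.comp_apply, (integral_mul_Lap z hG hφ (Or.inr hc)).2,
    (integral_mul_Lap z hφ hG (Or.inl hc)).2]
  simp only [mul_comm]

theorem sum_integral_dGr_mul {z : Plane} (hz : z ≠ 0) (hφ : ContDiff ℝ 2 φ)
    (hc : HasCompactSupport φ) :
    ∑ j, ∫ y, ‖y‖⁻¹ * (dGr 0 z j y * fderiv ℝ φ y (V z j y))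
      = φ z + ∫ y, φ y * (‖y‖ * f z y) := by
  refine tendsto_nhds_unique
    ((tendsto_finsetSum Finset.univ fun j _ =>
      (tendsto_integral_dGr_mul hz hφ hc j).2).comp tendsto_pow_four)
    ((tendsto_integral_mul_Lap_Gr hz hφ.continuous hc).congr' ?_)
  filter_upwards [self_mem_nhdsWithin] with t ht
  have ht4 : 0 < t ^ 4 := pow_pos (Set.mem_Ioi.1 ht) 4
  have hG := contDiff_Gr ht4 z (n := 2)
  rw [Function.comp_apply, (integral_mul_Lap z hG hφ (Or.inr hc)).2,
    ← integral_finsetSum _ fun j _ => (tendsto_integral_dGr_mul hz hφ hc j).1 _ ht4.le]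
  congr 1
  ext y
  rw [Finset.mul_sum]
  refine Finset.sum_congr rfl fun j _ => ?_
  rw [fderiv_Gr (by linarith [N_nonneg z y])]

/-- The two factors |y|⁻¹ from the fields meet the weight |y|. The points 0 and z, where the kernel
or the frame is singular, form a null set. -/
theorem along_mul_along (z : Plane) (j : Fin 4) :
    (fun y => ‖y‖⁻¹ * (dGr 0 z j y * fderiv ℝ φ y (V z j y))) =ᵐ[volume]
      fun y => along (Z z j) (fun w => Gam w z) y * along (Z z j) φ y * ‖y‖ := by
  filter_upwards [ae_ne 0, ae_ne z] with y hy hyz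
  have hy' : ‖y‖ ≠ 0 := norm_ne_zero_iff.2 hy
  have hG : (fun w => Gam w z) = Gr 0 z := funext fun w => Gam_eq_Gr z w
  rw [hG, along, along, Z_eq, map_smul, map_smul, fderiv_Gr (by simpa using N_pos hyz)]
  simp only [smul_eq_mul]
  field_simp

theorem locallyIntegrable_Gam (z : Plane) : LocallyIntegrable (fun y => Gam y z) volume := by
  have hC := CHR_pos
  simp only [Gam_eq_Gr]
  have hm : AEStronglyMeasurable (Gr 0 z) volume := by
    have := (continuous_N z).measurable
    exact Measurable.aestronglyMeasurable (by unfold Gr; fun_prop)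
  by_cases hz : z = 0
  -- At z = 0 the majorant is not available, but ω vanishes and Γ is a multiple of |y|⁻³.
  · subst hz
    refine ((locallyIntegrable_norm_inv_pow (k := 3) (by norm_num)).smul CHR⁻¹).mono hm
      (Eventually.of_forall fun y => le_of_eq ?_)
    have h : N 0 y = ‖y‖ ^ 4 := by simp [N, omega]
    rw [Gr, add_zero, h, ← Real.rpow_natCast, ← Real.rpow_mul (norm_nonneg y)]
    simp only [Pi.smul_apply, smul_eq_mul, norm_mul, norm_inv, norm_pow, norm_norm]
    congr 1
    rw [Real.norm_of_nonneg (by positivity),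
      show ((4 : ℕ) : ℝ) * -(3 / 4) = -((3 : ℕ) : ℝ) by norm_num, Real.rpow_neg (norm_nonneg y),
      Real.rpow_natCast, inv_pow]
  · refine ((locallyIntegrable_maj hz).smul CHR⁻¹).mono hm ?_
    filter_upwards [ae_ne z] with y hyz
    have hN := N_pos hyz
    simp only [Pi.smul_apply, smul_eq_mul, norm_mul, norm_inv]
    rw [Real.norm_of_nonneg hC.le, Real.norm_of_nonneg (maj_nonneg z y)]
    refine (abs_Gr_le le_rfl hyz).trans ?_
    gcongr
    rw [maj]
    exact le_mul_of_one_le_left (by positivity) (by linarith [sq_nonneg ‖y‖⁻¹])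

theorem locallyIntegrable_f (z : Plane) : LocallyIntegrable (f z) volume := by
  have hC := CHR_pos
  by_cases hz : z = 0
  -- The factor |z| in the bound forces f_z = 0 almost everywhere when z = 0.
  · refine (locallyIntegrable_const (0 : ℝ)).mono (aestronglyMeasurable_f z) ?_
    filter_upwards [ae_ne 0, ae_ne z] with y hy hyz
    have := abs_f_le_maj hy hyz
    simpa [hz] using this
  · refine ((locallyIntegrable_maj hz).smul (105 * CHR⁻¹ * ‖z‖)).mono (aestronglyMeasurable_f z) ?_
    filter_upwards [ae_ne 0, ae_ne z] with y hy hyz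
    have hN := N_pos hyz
    simp only [Pi.smul_apply, smul_eq_mul]
    rw [Real.norm_of_nonneg (mul_nonneg (by positivity) (maj_nonneg z y)), maj, ← mul_assoc]
    refine (abs_f_le_maj hy hyz).trans ?_
    gcongr <;> linarith

end Limit

end

end CharPlane

/-! ### The four assertions together -/

theorem mainTheorem1 :
    -- the explicit expression of `f_z`
    (∀ z y : Plane, y ≠ 0 → y ≠ z →
      f z y = 3 * d y z ^ (-11 : ℤ) / (4 * CHR * ‖y‖ ^ 2) *
        (-(7 / 4) * R13 y z + d y z ^ 4 * R23 y z + d y z ^ 4 * R33 y z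
          - 112 * omega z y ^ 4)) ∧
    -- the estimate of `f_z`, with an absolute constant
    (∃ C : ℝ, 0 < C ∧ ∀ z y : Plane, y ≠ 0 → y ≠ z →
      |f z y| ≤ C * ((√(‖z‖ * ‖y‖) + ‖z‖) / ‖y‖ ^ 2) * d y z ^ (-Q + 1)) ∧
    -- local integrability of `Γ(·, z)` and of `f_z`
    (∀ z : Plane, LocallyIntegrable (fun y => Gam y z) volume ∧
      LocallyIntegrable (f z) volume) ∧
    -- `Δ_z Γ(·, z) = δ_z + f_z`, tested against smooth compactly supported functions
    -- with respect to `|y| dy`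
    (∀ z : Plane, z ≠ 0 → ∀ φ : Plane → ℝ, ContDiff ℝ ∞ φ → HasCompactSupport φ →
      -- with all derivatives on the test function
      (Integrable (fun y => Gam y z * Lap z φ y * ‖y‖) volume ∧
        ∫ y, Gam y z * Lap z φ y * ‖y‖ = φ z + ∫ y, f z y * φ y * ‖y‖) ∧
      -- in the weak (divergence) form
      ((∀ j, Integrable
          (fun y => along (Z z j) (fun w => Gam w z) y * along (Z z j) φ y * ‖y‖) volume) ∧
        ∑ j, ∫ y, along (Z z j) (fun w => Gam w z) y * along (Z z j) φ y * ‖y‖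
          = φ z + ∫ y, f z y * φ y * ‖y‖)) := by
  refine ⟨fun z y hy hyz => f_eq hy hyz, exists_abs_f_le,
    fun z => ⟨locallyIntegrable_Gam z, locallyIntegrable_f z⟩, fun z hz φ hφ hc => ?_⟩
  have hφ2 : ContDiff ℝ 2 φ := hφ.of_le (by norm_cast)
  have e1 : (fun y => Gam y z * Lap z φ y * ‖y‖) = fun y => Gr 0 z y * (‖y‖ * Lap z φ y) := by
    ext y; rw [Gam_eq_Gr]; ring
  have e2 : (fun y => f z y * φ y * ‖y‖) = fun y => φ y * (‖y‖ * f z y) := by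
    ext y; ring
  rw [e1, e2]
  refine ⟨⟨(tendsto_integral_Gr_mul_Lap hz hφ2 hc).1, integral_Gam_mul_Lap hz hφ2 hc⟩,
    fun j => ((tendsto_integral_dGr_mul hz hφ2 hc j).1 0 le_rfl).congr (along_mul_along z j), ?_⟩
  rw [← sum_integral_dGr_mul hz hφ2 hc]
  exact Finset.sum_congr rfl fun j _ => (integral_congr_ae (along_mul_along z j)).symm
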